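/- Let $\mathfrak B$ be a complex Banach space and let $A:D(A)\subseteq\mathfrak B\to\mathfrak B$ be a sectorial operator: $A$ is linear, closed and densely defined, and there are $a\in\mathbb R$, $\varphi\in(0,\pi/2)$ and $c\in\mathbb R$ such that every $\lambda\in\mathbb C\setminus\{a\}$ with $\varphi\le|\arg(\lambda-a)|\le\pi$ lies in the resolvent set of $A$ and $\|(\lambda I-A)^{-1}\|\le c/(|\lambda-a|+1)$. Suppose that $A$ is hyperbolic, i.e. its spectrum satisfies $\sigma(A)\cap i\mathbb R=\emptyset$. Let $\hat\sigma(A)=\sigma(A)\cup\{\infty\}\subseteq\mathbb C\cup\{\infty\}$ be the extended spectrum; a subset of $\hat\sigma(A)$ that is both open and closed in $\hat\sigma(A)$ is called a spectral set. The spectral projection associated with a spectral set $\tau\not\ni\infty$ is the Riesz projection $\frac1{2\pi i}\oint_\Gamma(\lambda I-A)^{-1}d\lambda$, where $\Gamma$ is a cycle in the resolvent set with winding number $1$ around the points of $\tau$ and $0$ around the points of $\sigma(A)\setminus\tau$; if $\infty\in\tau$, it is $I$ minus the spectral projection associated with $\hat\sigma(A)\setminus\tau$. Put $\sigma_-(A)=\{\lambda\in\sigma(A):\operatorname{Re}\lambda<0\}$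 and $\hat\sigma_+(A)=\hat\sigma(A)\setminus\sigma_-(A)$. Then there is $\alpha>0$ such that: 1. $|\operatorname{Re}\lambda|\ge\alpha$ for every $\lambda\in\sigma(A)$. 2. $\sigma_-(A)$ is bounded and is a spectral set of $A$. 3. Let $P_-$ and $P_+$ be the spectral projections associated with $\sigma_-(A)$ and $\hat\sigma_+(A)$. They are projections with $P_-P_+=P_+P_-=0$ and $P_-+P_+=I$; they map $D(A)$ into itself and $AP_\pm x=P_\pm Ax$ for $x\in D(A)$. Let $\mathfrak B_\pm=P_\pm(\mathfrak B)$ and let $A_\pm=P_\pm A$, considered as an operator in $\mathfrak B_\pm$ with domain $D(A)\cap\mathfrak B_\pm$. Then $A_-$ is defined on all of $\mathfrak B_-$ and bounded, with $\sigma(A_-)=\sigma_-(A)$; and $A_+$ is a sectorial operator in $\mathfrak B_+$ with $\hat\sigma(A_+)=\hat\sigma_+(A)$. 4. $\operatorname{Re}\lambda\le-\alpha$ for every $\lambda\in\sigma(A_-)$, and $\operatorname{Re}\lambda>\alpha$ for every $\lambda\in\sigma(A_+)$. 5. $-A_+$ generates a $C_0$-semigroup $\{e^{-A_+t}\}_{t\ge0}$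 on $\mathfrak B_+$ that maps $\mathfrak B_+$ into $D(A_+)$ for $t>0$, and there are constants $\mathcal N>0$ and $\nu>0$ such that $\|e^{A_-t}\|\le\mathcal Ne^{-\nu t}$ for all $t\ge0$, and $\|e^{-A_+t}\|\le\mathcal Ne^{-\nu t}$ and $\|A_+e^{-A_+t}\|\le\mathcal Nt^{-1}e^{-\nu t}$ for all $t>0$. -/

import Mathlib

open Set Filter Topology

noncomputable section

/-! Unbounded operators are partial linear maps `A : E →ₗ.[ℂ] E`, with domain `A.domain`. -/

namespace LinearPMap

variable {E : Type*} [NormedAddCommGroup E] [NormedSpace ℂ E]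

/-- `R` is a bounded everywhere defined two-sided inverse of `z - A : D(A) → E`. -/
def IsResolventAt (A : E →ₗ.[ℂ] E) (z : ℂ) (R : E →L[ℂ] E) : Prop :=
  (∀ x : E, ∃ h : R x ∈ A.domain, z • R x - A ⟨R x, h⟩ = x) ∧
    ∀ y : A.domain, R (z • (y : E) - A y) = y

/-- The resolvent set of `A`. -/
def resolventSet (A : E →ₗ.[ℂ] E) : Set ℂ :=
  {z | ∃ R : E →L[ℂ] E, A.IsResolventAt z R}

/-- The spectrum of `A`. -/
def spectrum (A : E →ₗ.[ℂ] E) : Set ℂ := A.resolventSetᶜ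

/-- The extended spectrum of `A`: the spectrum together with the point at infinity of the
Riemann sphere. -/
def extSpectrum (A : E →ₗ.[ℂ] E) : Set (OnePoint ℂ) :=
  insert OnePoint.infty ((fun z : ℂ => (z : OnePoint ℂ)) '' A.spectrum)

open Classical in
/-- The resolvent `(z - A)⁻¹`, with the value `0` off the resolvent set. -/
def resolvent (A : E →ₗ.[ℂ] E) (z : ℂ) : E →L[ℂ] E :=
  if h : ∃ R : E →L[ℂ] E, A.IsResolventAt z R then h.choose else 0

/-- Sectorial operators: closed, densely defined, and a sector
`{z | φ ≤ |arg (z - a)| ≤ π}` with `a` real and `0 < φ < π / 2` lies in the resolvent set, with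
`‖(z - A)⁻¹‖ ≤ c / (|z - a| + 1)` there. (The vertex `z = a`, whose argument is undefined, is not
counted as a point of the sector: Lean's `arg 0` is `0 < φ`.) -/
def IsSectorial (A : E →ₗ.[ℂ] E) : Prop :=
  A.IsClosed ∧ Dense (A.domain : Set E) ∧
    ∃ (a φ c : ℝ), 0 < φ ∧ φ < Real.pi / 2 ∧
      ∀ z : ℂ, φ ≤ |Complex.arg (z - (a : ℂ))| →
        z ∈ A.resolventSet ∧ ‖A.resolvent z‖ ≤ c / (‖z - (a : ℂ)‖ + 1)

/-- No spectrum on the imaginary axis. -/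
def IsHyperbolic (A : E →ₗ.[ℂ] E) : Prop :=
  A.spectrum ∩ {z : ℂ | z.re = 0} = ∅

/-- A spectral set of `A`: a subset of the extended spectrum that is both open and closed in the
extended spectrum. -/
def IsSpectralSet (A : E →ₗ.[ℂ] E) (τ : Set (OnePoint ℂ)) : Prop :=
  τ ⊆ A.extSpectrum ∧ IsClopen ((↑) ⁻¹' τ : Set A.extSpectrum)

end LinearPMap

/-- A cycle in the plane: finitely many closed continuously differentiable curves, each
parametrized by `[0, 1]`. -/
def IsCycle {n : ℕ} (γ : Fin n → ℝ → ℂ) : Prop :=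
  ∀ i, ContDiff ℝ 1 (γ i) ∧ γ i 0 = γ i 1

/-- The contour integral `∮_γ f(z) dz` along a cycle. -/
def cycleIntegral {F : Type*} [NormedAddCommGroup F] [NormedSpace ℂ F] {n : ℕ}
    (γ : Fin n → ℝ → ℂ) (f : ℂ → F) : F :=
  ∑ i, ∫ t in (0 : ℝ)..1, deriv (γ i) t • f (γ i t)

/-- The winding number of a cycle around a point off the cycle. -/
def cycleWinding {n : ℕ} (γ : Fin n → ℝ → ℂ) (w : ℂ) : ℂ :=
  (2 * (Real.pi : ℂ) * Complex.I)⁻¹ * cycleIntegral γ (fun z => (z - w)⁻¹)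

namespace LinearPMap

variable {E : Type*} [NormedAddCommGroup E] [NormedSpace ℂ E]

/-- `P = (2πi)⁻¹ ∮_γ (z - A)⁻¹ dz`, where `γ` is a cycle in the resolvent set that winds once
around every point of `σ` and does not wind around the other points of the spectrum. -/
def IsRieszIntegral (A : E →ₗ.[ℂ] E) (σ : Set ℂ) (P : E →L[ℂ] E) : Prop :=
  ∃ (n : ℕ) (γ : Fin n → ℝ → ℂ), IsCycle γ ∧
    (∀ i, ∀ t ∈ Icc (0 : ℝ) 1, γ i t ∈ A.resolventSet) ∧
    (∀ w ∈ σ, cycleWinding γ w = 1) ∧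
    (∀ w ∈ A.spectrum \ σ, cycleWinding γ w = 0) ∧
    P = (2 * (Real.pi : ℂ) * Complex.I)⁻¹ • cycleIntegral γ A.resolvent

/-- `P` is the spectral projection of `A` associated with the spectral set `τ` of the extended
spectrum. If `∞ ∉ τ`, it is the Riesz integral around `τ`; if `∞ ∈ τ`, it is the identity minus
the Riesz integral around the remaining part of the spectrum. -/
def IsSpectralProjection (A : E →ₗ.[ℂ] E) (τ : Set (OnePoint ℂ)) (P : E →L[ℂ] E) : Prop :=
  A.IsSpectralSet τ ∧
    ((OnePoint.infty ∉ τ ∧ A.IsRieszIntegral {z : ℂ | (z : OnePoint ℂ) ∈ τ} P) ∨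
      (OnePoint.infty ∈ τ ∧
        A.IsRieszIntegral {z : ℂ | z ∈ A.spectrum ∧ (z : OnePoint ℂ) ∉ τ} (1 - P)))

/-- The range of `P`, as a subspace of `E`. -/
abbrev rangeOf (P : E →L[ℂ] E) : Submodule ℂ E := LinearMap.range (P : E →ₗ[ℂ] E)

/-- The operator `P A` on the range of `P`: its domain is `D(A) ∩ P(E)`, and it maps `x` to
`P (A x)`. -/
def part (A : E →ₗ.[ℂ] E) (P : E →L[ℂ] E) : rangeOf P →ₗ.[ℂ] rangeOf P where
  domain := A.domain.comap (rangeOf P).subtype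
  toFun :=
    { toFun := fun x => ⟨P (A ⟨((x : rangeOf P) : E), x.2⟩), ⟨_, rfl⟩⟩
      map_add' := fun x y => by
        ext
        change P (A (⟨_, x.2⟩ + ⟨_, y.2⟩)) = _
        rw [LinearPMap.map_add, _root_.map_add]
        rfl
      map_smul' := fun c x => by
        ext
        change P (A (c • ⟨_, x.2⟩)) = _
        rw [LinearPMap.map_smul, _root_.map_smul]
        rfl }

/-- `P` maps `D(A)` to itself and commutes with `A` there. -/
def CommutesWith (A : E →ₗ.[ℂ] E) (P : E →L[ℂ] E) : Prop :=
  ∀ x : A.domain, ∃ h : P x ∈ A.domain, A ⟨P x, h⟩ = P (A x)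

end LinearPMap

/-- The exponential `∑ Bᵏ / k!` of a bounded operator. -/
def operatorExp {F : Type*} [NormedAddCommGroup F] [NormedSpace ℂ F] (B : F →L[ℂ] F) :
    F →L[ℂ] F :=
  NormedSpace.exp B

/-- Strongly continuous (`C₀`) semigroups of bounded operators, indexed by `t ≥ 0`
(the values at `t < 0` are irrelevant). -/
structure IsC0Semigroup {E : Type*} [NormedAddCommGroup E] [NormedSpace ℂ E]
    (T : ℝ → E →L[ℂ] E) : Prop where
  zero : T 0 = 1
  add : ∀ s t : ℝ, 0 ≤ s → 0 ≤ t → T (s + t) = T s * T t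
  tendsto : ∀ x : E, Tendsto (fun t => T t x) (𝓝[>] 0) (𝓝 x)

/-- `T` is the `C₀`-semigroup `e^{Gt}` generated by `G`: the graph of `G` consists of the pairs
`(x, y)` for which `(T(t)x - x) / t` tends to `y` as `t` tends to `0` from the right. -/
def IsSemigroupGeneratedBy {E : Type*} [NormedAddCommGroup E] [NormedSpace ℂ E]
    (T : ℝ → E →L[ℂ] E) (G : E →ₗ.[ℂ] E) : Prop :=
  IsC0Semigroup T ∧
    ∀ x y : E, (x, y) ∈ G.graph ↔
      Tendsto (fun t : ℝ => ((t⁻¹ : ℝ) : ℂ) • (T t x - x)) (𝓝[>] 0) (𝓝 y)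

end

/-! A sectorial operator has only a compact piece of spectrum in each half-plane Re z ≤ b, so
hyperbolicity gives a gap |Re λ| ≥ 2α (`IsSectorial.exists_gap`). The left piece then fits into one
disc contained in Re z ≤ -α (`IsSectorial.exists_circle`), and a single circle serves as the
contour.

The splitting rests on the Cauchy transform Φ(w) = (2πi)⁻¹ ∮ (z - w)⁻¹ R(z) dz of the resolvent R,
which satisfies (w - A) Φ(w) = n(w) - P, with n the winding number and P the Riesz projection
(`cauchyResolvent_spec`). Inside the circle Φ(w) inverts w - A on ker P; outside, -Φ(w) inverts it
on ran P. This locates the spectra of both parts (`spectrum_part_rieszProj`). Moreover Φ is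
holomorphic inside and equals R(w)(1 - P) at points of the resolvent set there, so integrating over
a slightly smaller circle yields P(1 - P) = 0 (`rieszProj_mul_self`).

On ran P the operator is bounded and its exponential is the Dunford integral of e^{tz}, where
|e^{tz}| ≤ e^{-αt} on the circle.

On ker P the part B satisfies ‖(z - B)⁻¹‖ ≤ C / |z - α| for Re z < α. With G = B - α, Laplace
inversion integrated by parts twice reads e^{-tG} = (πt²)⁻¹ ∫ e^{tz} (z + G)⁻³ d(Im z). This
converges absolutely on vertical lines, so no contour has to be bent into the sector, and the line
Re z = 1/t gives ‖e^{-tG}‖ ≤ eC³ and ‖G e^{-tG}‖ ≤ e(C² + C³)/t. The differential equation gives the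
semigroup law (`laplaceSemigroup_add`), and comparison with the scalar inversion of z⁻³ gives strong
continuity at 0. Restoring the factor e^{-αt} gives the semigroup of -B. -/

noncomputable section

/-! ### Integrals over vertical lines. -/

section VerticalIntegral

open MeasureTheory Complex

variable {F : Type*} [NormedAddCommGroup F] [NormedSpace ℂ F]

/-- The integral of `g` along the vertical line `Re z = h`, with respect to `Im z`. -/
def verticalIntegral (h : ℝ) (g : ℂ → F) : F := ∫ y : ℝ, g (h + y * I)

lemma re_vertical (h y : ℝ) : ((h : ℂ) + y * I).re = h := by simp

lemma im_vertical (h y : ℝ) : ((h : ℂ) + y * I).im = y := by simp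

lemma norm_vertical_sq (h y : ℝ) : ‖(h : ℂ) + y * I‖ ^ 2 = h ^ 2 + y ^ 2 := by
  rw [Complex.sq_norm, Complex.normSq_apply, re_vertical, im_vertical]; ring

lemma continuous_vertical (h : ℝ) : Continuous fun y : ℝ => (h : ℂ) + y * I := by fun_prop

lemma norm_vertical_sq_inv {h : ℝ} (hh : 0 < h) (y : ℝ) :
    (‖(h : ℂ) + y * I‖ ^ 2)⁻¹ = (h ^ 2)⁻¹ * (1 + (h⁻¹ * y) ^ 2)⁻¹ := by
  rw [norm_vertical_sq]
  field_simp

lemma integrable_norm_vertical_sq_inv {h : ℝ} (hh : 0 < h) :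
    Integrable fun y : ℝ => (‖(h : ℂ) + y * I‖ ^ 2)⁻¹ := by
  simp_rw [norm_vertical_sq_inv hh]
  exact (integrable_inv_one_add_sq.comp_mul_left' (inv_ne_zero hh.ne')).const_mul _

/-- Rescaling the integral of 1/(1 + y²). For h = 1/t the value is πt, the source of the powers of t
in the semigroup estimates. -/
lemma integral_norm_vertical_sq_inv {h : ℝ} (hh : 0 < h) :
    ∫ y : ℝ, (‖(h : ℂ) + y * I‖ ^ 2)⁻¹ = Real.pi / h := by
  simp_rw [norm_vertical_sq_inv hh]
  rw [integral_const_mul, Measure.integral_comp_mul_left (fun y : ℝ => (1 + y ^ 2)⁻¹),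
    integral_univ_inv_one_add_sq, inv_inv, abs_of_pos hh, smul_eq_mul]
  field_simp

lemma integrable_vertical {G : Type*} [NormedAddCommGroup G] {h M : ℝ} (hh : 0 < h) {g : ℂ → G}
    (hg : Continuous fun y : ℝ => g (h + y * I))
    (hb : ∀ y : ℝ, ‖g (h + y * I)‖ ≤ M / ‖(h : ℂ) + y * I‖ ^ 2) :
    Integrable fun y : ℝ => g (h + y * I) :=
  ((integrable_norm_vertical_sq_inv hh).const_mul M).mono' hg.aestronglyMeasurable
    (Eventually.of_forall fun y => by simpa [div_eq_mul_inv] using hb y)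

lemma norm_verticalIntegral_le {h M : ℝ} (hh : 0 < h) {g : ℂ → F}
    (hb : ∀ y : ℝ, ‖g (h + y * I)‖ ≤ M / ‖(h : ℂ) + y * I‖ ^ 2) :
    ‖verticalIntegral h g‖ ≤ M * (Real.pi / h) := by
  rw [← integral_norm_vertical_sq_inv hh, ← integral_const_mul]
  exact norm_integral_le_of_norm_le ((integrable_norm_vertical_sq_inv hh).const_mul M)
    (Eventually.of_forall fun y => by simpa [div_eq_mul_inv] using hb y)

lemma tendsto_const_div_vertical (M h : ℝ) {l : Filter ℝ} (hl : Tendsto (fun y : ℝ => |y|) l atTop) :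
    Tendsto (fun y : ℝ => M / ‖(h : ℂ) + y * I‖ ^ 2) l (𝓝 0) := by
  refine Tendsto.div_atTop tendsto_const_nhds ?_
  refine tendsto_atTop_mono (fun y => ?_) ((tendsto_pow_atTop (two_ne_zero)).comp hl)
  rw [norm_vertical_sq]
  simp only [Function.comp, sq_abs]
  nlinarith [sq_nonneg h]

/-- Vertical integrals of a holomorphic function with quadratic decay do not depend on the line. -/
theorem verticalIntegral_eq_of_lt [CompleteSpace F] {a b M : ℝ} (ha : 0 < a) (hab : a < b) {g : ℂ → F}
    (hg : ∀ z : ℂ, 0 < z.re → DifferentiableAt ℂ g z)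
    (hb : ∀ z : ℂ, a ≤ z.re → z.re ≤ b → ‖g z‖ ≤ M / ‖z‖ ^ 2) :
    verticalIntegral a g = verticalIntegral b g := by
  have hM : 0 ≤ M := by
    have h1 := (norm_nonneg _).trans (hb (a : ℂ) (by simp) (by simpa using hab.le))
    have h2 : 0 < ‖(a : ℂ)‖ ^ 2 := by
      have : (a : ℂ) ≠ 0 := by exact_mod_cast ha.ne'
      positivity
    rw [le_div_iff₀ h2] at h1
    simpa using h1
  have hint : ∀ h : ℝ, a ≤ h → h ≤ b → Integrable fun y : ℝ => g (h + y * I) := by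
    intro h h1 h2
    refine integrable_vertical (ha.trans_le h1) (M := M) ?_ fun y => hb _ (by simpa) (by simpa)
    refine continuous_iff_continuousAt.2 fun y => ?_
    exact ContinuousAt.comp (f := fun y : ℝ => (h : ℂ) + y * I)
      (hg _ (by simpa using ha.trans_le h1)).continuousAt (continuous_vertical h).continuousAt
  have hlim : ∀ h : ℝ, a ≤ h → h ≤ b →
      Tendsto (fun Y : ℝ => I • ∫ y : ℝ in (-Y)..Y, g (h + y * I)) atTop
        (𝓝 (I • verticalIntegral h g)) := fun h h1 h2 =>
    (intervalIntegral_tendsto_integral (hint h h1 h2) tendsto_neg_atTop_atBot tendsto_id).const_smul _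
  -- Horizontal sides of the rectangle: the modulus is smallest at the left end, so quadratic decay
  -- there makes them vanish. The function `s` covers both the heights Y and -Y.
  have hhor : ∀ s : ℝ → ℝ, Tendsto (fun Y => |s Y|) atTop atTop →
      Tendsto (fun Y : ℝ => ∫ x : ℝ in a..b, g (x + (s Y : ℝ) * I)) atTop (𝓝 0) := by
    intro s hs
    refine squeeze_zero_norm (a := fun Y => M / ‖(a : ℂ) + (s Y : ℝ) * I‖ ^ 2 * |b - a|) (fun Y => ?_) ?_
    · refine intervalIntegral.norm_integral_le_of_norm_le_const fun x hx => ?_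
      rw [uIoc_of_le hab.le] at hx
      refine (hb _ (by simpa using hx.1.le) (by simpa using hx.2)).trans ?_
      refine div_le_div_of_nonneg_left hM ?_ ?_
      · rw [norm_vertical_sq]; positivity
      · rw [norm_vertical_sq, norm_vertical_sq]
        have := hx.1
        gcongr
    · have := (tendsto_const_div_vertical M a (l := map s atTop) (tendsto_map'_iff.2 hs))
      simpa using (tendsto_map'_iff.1 this).mul_const |b - a|
  have hrect : ∀ Y : ℝ, (∫ x : ℝ in a..b, g (x + ((-Y : ℝ) : ℂ) * I)) -
      (∫ x : ℝ in a..b, g (x + (Y : ℝ) * I)) + I • (∫ y : ℝ in (-Y)..Y, g (b + y * I)) -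
      I • (∫ y : ℝ in (-Y)..Y, g (a + y * I)) = 0 := by
    intro Y
    have := Complex.integral_boundary_rect_eq_zero_of_differentiableOn g (⟨a, -Y⟩ : ℂ) ⟨b, Y⟩ ?_
    · simpa using this
    · intro z hz
      refine (hg z ?_).differentiableWithinAt
      have : z.re ∈ uIcc a b := hz.1
      rw [uIcc_of_le hab.le] at this
      exact ha.trans_le this.1
  have hsum := (((hhor (fun Y => -Y) (by simpa using tendsto_abs_atTop_atTop)).sub
    (hhor (fun Y => Y) tendsto_abs_atTop_atTop)).add (hlim b hab.le le_rfl)).sub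
    (hlim a le_rfl hab.le)
  have h0 := tendsto_nhds_unique hsum (tendsto_const_nhds.congr fun Y => (hrect Y).symm)
  rw [sub_zero, zero_add, ← smul_sub, smul_eq_zero] at h0
  rcases h0 with h0 | h0
  · exact absurd h0 I_ne_zero
  · exact (sub_eq_zero.1 h0).symm

end VerticalIntegral


/-! ### Scalar Laplace inversion of z⁻³. -/

section LaplaceInversion

open MeasureTheory Complex FourierTransform

lemma tendsto_pow_mul_cexp_neg_mul (n : ℕ) {s : ℂ} (hs : 0 < s.re) :
    Tendsto (fun u : ℝ => (u : ℂ) ^ n * exp (-(s * u))) atTop (𝓝 0) := by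
  have h1 : Tendsto (fun u : ℝ => (s.re * u) ^ n * Real.exp (-(s.re * u))) atTop (𝓝 0) :=
    (Real.tendsto_pow_mul_exp_neg_atTop_nhds_zero n).comp (tendsto_id.const_mul_atTop hs)
  have h2 := h1.const_mul ((s.re ^ n)⁻¹)
  rw [mul_zero] at h2
  refine squeeze_zero_norm' ?_ h2
  filter_upwards [eventually_ge_atTop 0] with u hu
  rw [norm_mul, norm_pow, norm_exp, Complex.norm_of_nonneg hu]
  simp only [neg_re, mul_re, ofReal_re, ofReal_im, mul_zero, sub_zero]
  rw [mul_pow]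
  have : s.re ^ n ≠ 0 := by positivity
  field_simp
  rfl

lemma integrableOn_sq_mul_cexp_neg_mul {s : ℂ} (hs : 0 < s.re) :
    IntegrableOn (fun u : ℝ => (u : ℂ) ^ 2 * exp (-(s * u))) (Ioi 0) := by
  have h1 := integrableOn_rpow_mul_exp_neg_mul_rpow (s := 2) (p := 1) (by norm_num) one_pos hs
  refine Integrable.mono' h1 (by fun_prop) ?_
  refine (ae_restrict_mem measurableSet_Ioi).mono fun u hu => ?_
  rw [norm_mul, norm_pow, norm_exp, Complex.norm_of_nonneg (le_of_lt hu)]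
  simp

lemma integral_sq_mul_cexp_neg_mul {s : ℂ} (hs : 0 < s.re) :
    ∫ u : ℝ in Ioi 0, (u : ℂ) ^ 2 * exp (-(s * u)) = 2 / s ^ 3 := by
  have hs0 : s ≠ 0 := by rintro rfl; simp at hs
  -- An explicit antiderivative, from integrating by parts twice. The powers 1 and 0 stay written
  -- out so that one limit lemma and one derivative formula cover all three terms.
  set f : ℝ → ℂ := fun u => -((u : ℂ) ^ 2 * exp (-(s * u)) / s + 2 * ((u : ℂ) ^ 1 * exp (-(s * u))) / s ^ 2
    + 2 * ((u : ℂ) ^ 0 * exp (-(s * u))) / s ^ 3) with hf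
  have hder : ∀ u : ℝ, HasDerivAt f ((u : ℂ) ^ 2 * exp (-(s * u))) u := by
    intro u
    have he : HasDerivAt (fun u : ℝ => exp (-(s * u))) (exp (-(s * u)) * (-s)) u := by
      have : HasDerivAt (fun u : ℝ => -(s * (u : ℂ))) (-s) u := by
        simpa using ((hasDerivAt_id u).ofReal_comp.const_mul s).fun_neg
      exact this.cexp
    have hp : ∀ n : ℕ, HasDerivAt (fun u : ℝ => (u : ℂ) ^ n) (n * (u : ℂ) ^ (n - 1)) u := fun n => by
      simpa using (hasDerivAt_id u).ofReal_comp.fun_pow n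
    have := (((((hp 2).mul he).div_const s).add ((((hp 1).mul he).const_mul 2).div_const (s ^ 2))).add
      ((((hp 0).mul he).const_mul 2).div_const (s ^ 3))).neg
    refine this.congr_deriv ?_
    field_simp
    push_cast
    ring
  have hlim : Tendsto f atTop (𝓝 0) := by
    have := (((tendsto_pow_mul_cexp_neg_mul 2 hs).div_const s).add
      (((tendsto_pow_mul_cexp_neg_mul 1 hs).const_mul 2).div_const (s ^ 2))).add
      (((tendsto_pow_mul_cexp_neg_mul 0 hs).const_mul 2).div_const (s ^ 3))
    simpa [hf] using this.neg
  rw [integral_Ioi_of_hasDerivAt_of_tendsto (hder 0).continuousAt.continuousWithinAt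
    (fun u _ => hder u) (integrableOn_sq_mul_cexp_neg_mul hs) hlim]
  simp [hf]

/-- This Fourier transform at ξ is the Laplace transform of u² at h + 2πiξ, so Fourier inversion
becomes Laplace inversion along Re z = h. -/
lemma fourier_indicator_sq_mul_cexp {h : ℝ} (hh : 0 < h) (ξ : ℝ) :
    𝓕 ((Ioi (0 : ℝ)).indicator fun u : ℝ => (u : ℂ) ^ 2 * exp (-(h * u))) ξ =
      2 / ((h : ℂ) + (2 * Real.pi * ξ : ℝ) * I) ^ 3 := by
  rw [Real.fourier_real_eq_integral_exp_smul,
    ← integral_sq_mul_cexp_neg_mul (s := (h : ℂ) + (2 * Real.pi * ξ : ℝ) * I) (by simpa using hh),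
    ← integral_indicator measurableSet_Ioi]
  refine integral_congr_ae (Eventually.of_forall fun u => ?_)
  by_cases hu : u ∈ Ioi (0 : ℝ)
  · simp only [indicator_of_mem hu, smul_eq_mul]
    rw [mul_left_comm, ← exp_add]
    congr 2
    push_cast
    ring
  · simp [indicator_of_notMem hu]

/-- The inverse Laplace transform of `z⁻³` is `t² / 2`. -/
theorem verticalIntegral_exp_mul_inv_cube {h t : ℝ} (hh : 0 < h) (ht : 0 < t) :
    verticalIntegral h (fun z => exp (t * z) * (z ^ 3)⁻¹) = Real.pi * t ^ 2 := by
  set f : ℝ → ℂ := (Ioi (0 : ℝ)).indicator fun u : ℝ => (u : ℂ) ^ 2 * exp (-(h * u)) with hf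
  have hcube : Integrable fun y : ℝ => 2 / ((h : ℂ) + y * I) ^ 3 := by
    refine integrable_vertical (M := 2 / h) hh (g := fun z : ℂ => 2 / z ^ 3) ?_ fun y => ?_
    · refine Continuous.div continuous_const (by fun_prop) fun y => pow_ne_zero _ fun h0 => ?_
      have := re_vertical h y
      rw [h0] at this
      exact hh.ne this
    · have h1 : h ≤ ‖(h : ℂ) + y * I‖ := by
        simpa [re_vertical, abs_of_pos hh] using abs_re_le_norm ((h : ℂ) + y * I)
      have h2 : 0 < ‖(h : ℂ) + y * I‖ := hh.trans_le h1
      rw [norm_div, norm_pow, div_div, pow_succ, mul_comm]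
      simp only [RCLike.norm_ofNat]
      gcongr
  have hfi : Integrable f :=
    (integrable_indicator_iff measurableSet_Ioi).2 (integrableOn_sq_mul_cexp_neg_mul (by simpa using hh))
  have hFf : 𝓕 f = fun ξ : ℝ => 2 / ((h : ℂ) + (2 * Real.pi * ξ : ℝ) * I) ^ 3 :=
    funext fun ξ => fourier_indicator_sq_mul_cexp hh ξ
  have hFi : Integrable (𝓕 f) := by
    rw [hFf]
    exact hcube.comp_mul_left' (by positivity)
  have hc : ContinuousAt f t := by
    have : f =ᶠ[𝓝 t] fun u : ℝ => (u : ℂ) ^ 2 * exp (-(h * u)) := by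
      filter_upwards [Ioi_mem_nhds ht] with u hu
      exact indicator_of_mem hu _
    exact ContinuousAt.congr (by fun_prop) this.symm
  have key := hfi.fourierInv_fourier_eq hFi hc
  rw [Real.fourierInv_eq', hFf] at key
  -- The substitution y = 2πξ; the factor e^{-ht} turns the oscillation e^{ity} into e^{tz} on the
  -- line.
  have h3 : (fun ξ : ℝ => exp (↑(2 * Real.pi * inner ℝ ξ t) * I) •
      (2 / ((h : ℂ) + (2 * Real.pi * ξ : ℝ) * I) ^ 3)) = fun ξ : ℝ =>
      (fun y : ℝ => exp (-(h * t)) * 2 * (exp (t * ((h : ℂ) + y * I)) * (((h : ℂ) + y * I) ^ 3)⁻¹))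
        (2 * Real.pi * ξ) := by
    ext ξ
    simp only [RCLike.inner_apply, conj_trivial, smul_eq_mul]
    have : exp (↑(2 * Real.pi * (t * ξ)) * I) =
        exp (-(h * t)) * exp (t * ((h : ℂ) + (2 * Real.pi * ξ : ℝ) * I)) := by
      rw [← exp_add]
      congr 1
      push_cast
      ring
    rw [this]
    ring
  rw [h3, Measure.integral_comp_mul_left (fun y : ℝ => exp (-(h * t)) * 2 *
    (exp (t * ((h : ℂ) + y * I)) * (((h : ℂ) + y * I) ^ 3)⁻¹)), integral_const_mul, hf, indicator_of_mem (mem_Ioi.2 ht)] at key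
  have hpi : (0 : ℝ) < (2 * Real.pi)⁻¹ := by positivity
  rw [abs_of_pos hpi, Complex.real_smul] at key
  have hpi' : (Real.pi : ℂ) ≠ 0 := by exact_mod_cast Real.pi_ne_zero
  have he := exp_ne_zero (-(h * t : ℂ))
  rw [verticalIntegral]
  push_cast at key
  field_simp at key
  simpa only [div_eq_mul_inv] using key

end LaplaceInversion

/-! ### Pseudo-resolvents and the integrals defining the semigroup. -/

/-- A pseudo-resolvent `q` on the right half-plane with `‖q z‖ ≤ C / ‖z‖`: it behaves like
`(z + G)⁻¹` for an operator `G`. -/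
structure IsPseudoResolvent {𝓐 : Type*} [NormedRing 𝓐] [NormedAlgebra ℂ 𝓐] (q : ℂ → 𝓐) (C : ℝ) :
    Prop where
  identity : ∀ z w : ℂ, 0 < z.re → 0 < w.re → q z - q w = (w - z) • (q z * q w)
  bound : ∀ z : ℂ, 0 < z.re → ‖q z‖ ≤ C / ‖z‖

/-- The semigroup `e^{-tG}`, written as an inverse Laplace transform of the cube of the
pseudo-resolvent `(z + G)⁻¹`. -/
def laplaceSemigroup {𝓐 : Type*} [NormedRing 𝓐] [NormedAlgebra ℂ 𝓐] (q : ℂ → 𝓐) (t : ℝ) : 𝓐 :=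
  ((Real.pi : ℂ) * t ^ 2)⁻¹ • verticalIntegral t⁻¹ fun z => Complex.exp (t * z) • q z ^ 3

/-- The operator `G e^{-tG}`. -/
def laplaceSemigroupGen {𝓐 : Type*} [NormedRing 𝓐] [NormedAlgebra ℂ 𝓐] (q : ℂ → 𝓐) (t : ℝ) : 𝓐 :=
  ((Real.pi : ℂ) * t ^ 2)⁻¹ • verticalIntegral t⁻¹ fun z =>
    Complex.exp (t * z) • (q z ^ 2 - z • q z ^ 3)

namespace IsPseudoResolvent

open MeasureTheory Complex

variable {𝓐 : Type*} [NormedRing 𝓐] [NormedAlgebra ℂ 𝓐] {q : ℂ → 𝓐} {C : ℝ}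

lemma ne_zero_of_re_pos {z : ℂ} (hz : 0 < z.re) : z ≠ 0 := by rintro rfl; simp at hz

lemma norm_pos_of_re_pos {z : ℂ} (hz : 0 < z.re) : 0 < ‖z‖ := norm_pos_iff.2 (ne_zero_of_re_pos hz)

lemma nonneg (hq : IsPseudoResolvent q C) : 0 ≤ C := by
  simpa using (norm_nonneg _).trans (hq.bound 1 (by simp))

lemma commute (hq : IsPseudoResolvent q C) {z w : ℂ} (hz : 0 < z.re) (hw : 0 < w.re) :
    Commute (q z) (q w) := by
  rcases eq_or_ne z w with rfl | h
  · exact Commute.refl _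
  · have h1 := hq.identity z w hz hw
    have h2 := hq.identity w z hw hz
    have h3 : (w - z) • (q z * q w) = (w - z) • (q w * q z) := by
      rw [← h1, ← neg_sub z w, neg_smul, ← h2, neg_sub]
    exact smul_right_injective 𝓐 (sub_ne_zero.2 h.symm) h3

lemma norm_pow_le (hq : IsPseudoResolvent q C) {z : ℂ} (hz : 0 < z.re) {n : ℕ} (hn : 0 < n) :
    ‖q z ^ n‖ ≤ C ^ n / ‖z‖ ^ n := by
  rw [← div_pow]
  exact (norm_pow_le' _ hn).trans (pow_le_pow_left₀ (norm_nonneg _) (hq.bound z hz) n)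

/-- The resolvent identity bounds q(w) - q(z) by |z - w| times factors that stay bounded near z;
applied once more, it yields the derivative -q². -/
lemma continuousAt (hq : IsPseudoResolvent q C) {z : ℂ} (hz : 0 < z.re) : ContinuousAt q z := by
  rw [ContinuousAt, tendsto_iff_norm_sub_tendsto_zero]
  have hev : ∀ᶠ w in 𝓝 z, 0 < w.re := continuous_re.continuousAt.eventually (lt_mem_nhds hz)
  have hb : Tendsto (fun w : ℂ => ‖z - w‖ * (C / ‖w‖ * (C / ‖z‖))) (𝓝 z) (𝓝 0) := by
    have : ContinuousAt (fun w : ℂ => ‖z - w‖ * (C / ‖w‖ * (C / ‖z‖))) z := by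
      have := (norm_pos_of_re_pos hz).ne'
      fun_prop (disch := assumption)
    simpa [ContinuousAt] using this
  refine squeeze_zero' (Eventually.of_forall fun _ => norm_nonneg _) ?_ hb
  filter_upwards [hev] with w hw
  rw [hq.identity w z hw hz, norm_smul]
  refine mul_le_mul_of_nonneg_left ((norm_mul_le _ _).trans ?_) (norm_nonneg _)
  exact mul_le_mul (hq.bound w hw) (hq.bound z hz) (norm_nonneg _)
    (div_nonneg hq.nonneg (norm_nonneg _))

lemma hasDerivAt (hq : IsPseudoResolvent q C) {z : ℂ} (hz : 0 < z.re) :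
    HasDerivAt q (-(q z ^ 2)) z := by
  rw [hasDerivAt_iff_tendsto_slope]
  have hev : ∀ᶠ w in 𝓝[≠] z, 0 < w.re :=
    nhdsWithin_le_nhds (continuous_re.continuousAt.eventually (lt_mem_nhds hz))
  have hlim : Tendsto (fun w => -(q w * q z)) (𝓝[≠] z) (𝓝 (-(q z ^ 2))) := by
    rw [sq]
    exact (((hq.continuousAt hz).tendsto.mono_left nhdsWithin_le_nhds).mul_const _).neg
  refine hlim.congr' ?_
  filter_upwards [hev, self_mem_nhdsWithin] with w hw hwz
  have : w - z ≠ 0 := sub_ne_zero.2 hwz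
  rw [slope_def_module, hq.identity w z hw hz, smul_smul, ← neg_sub w z, mul_neg,
    inv_mul_cancel₀ this, neg_one_smul]

lemma hasDerivAt_sq (hq : IsPseudoResolvent q C) {z : ℂ} (hz : 0 < z.re) :
    HasDerivAt (fun z => q z ^ 2) (-(2 : ℂ) • q z ^ 3) z := by
  have := (hq.hasDerivAt hz).mul (hq.hasDerivAt hz)
  have h2 : (fun z => q z ^ 2) = q * q := by ext; simp [sq]
  rw [h2]
  refine this.congr_deriv ?_
  rw [neg_smul, two_smul]
  noncomm_ring

lemma differentiableAt_exp_smul_pow (hq : IsPseudoResolvent q C) (t : ℝ) (n : ℕ) {z : ℂ}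
    (hz : 0 < z.re) : DifferentiableAt ℂ (fun z => exp (t * z) • q z ^ n) z :=
  DifferentiableAt.fun_smul (by fun_prop) ((hq.hasDerivAt hz).differentiableAt.pow n)

lemma continuous_vertical_comp {F : Type*} [TopologicalSpace F] {g : ℂ → F}
    (hg : ∀ z : ℂ, 0 < z.re → ContinuousAt g z) {h : ℝ} (hh : 0 < h) :
    Continuous fun y : ℝ => g (h + y * I) :=
  continuous_iff_continuousAt.2 fun y => ContinuousAt.comp (f := fun y : ℝ => (h : ℂ) + y * I)
    (hg _ (by simpa using hh)) (continuous_vertical h).continuousAt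

lemma norm_exp_mul (t : ℝ) (z : ℂ) : ‖exp (t * z)‖ = Real.exp (t * z.re) := by
  rw [norm_exp]; simp

/-- Decay of `e^{tz} q(z)³` on vertical strips. -/
lemma norm_exp_smul_cube_le (hq : IsPseudoResolvent q C) {t a b : ℝ} (ht : 0 ≤ t) (ha : 0 < a)
    {z : ℂ} (h1 : a ≤ z.re) (h2 : z.re ≤ b) :
    ‖exp (t * z) • q z ^ 3‖ ≤ Real.exp (t * b) * (C ^ 3 / a) / ‖z‖ ^ 2 := by
  have hz := ha.trans_le h1
  have h3 : a ≤ ‖z‖ := h1.trans (re_le_norm z)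
  have hC := hq.nonneg
  rw [norm_smul, norm_exp_mul, mul_div_assoc]
  have h4 : ‖q z ^ 3‖ ≤ C ^ 3 / a / ‖z‖ ^ 2 := by
    refine (hq.norm_pow_le hz three_pos).trans ?_
    rw [div_div, show ‖z‖ ^ 3 = ‖z‖ * ‖z‖ ^ 2 by ring]
    have := norm_pos_of_re_pos hz
    gcongr
  gcongr

lemma norm_exp_smul_sq_le (hq : IsPseudoResolvent q C) {t : ℝ} {z : ℂ} (hz : 0 < z.re) :
    ‖exp (t * z) • q z ^ 2‖ ≤ Real.exp (t * z.re) * C ^ 2 / ‖z‖ ^ 2 := by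
  rw [norm_smul, norm_exp_mul, mul_div_assoc]
  exact mul_le_mul_of_nonneg_left (hq.norm_pow_le hz two_pos) (Real.exp_pos _).le

/-- For q = (z + G)⁻¹ this expression is G q(z)³. Applying G costs one power of decay, and the
remaining |z|⁻² is still integrable on vertical lines; this is why the cube is used. -/
lemma norm_sq_sub_le (hq : IsPseudoResolvent q C) {z : ℂ} (hz : 0 < z.re) :
    ‖q z ^ 2 - z • q z ^ 3‖ ≤ (C ^ 2 + C ^ 3) / ‖z‖ ^ 2 := by
  have h0 := norm_pos_of_re_pos hz
  refine (norm_sub_le _ _).trans ?_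
  rw [add_div]
  refine add_le_add (hq.norm_pow_le hz two_pos) ?_
  rw [norm_smul]
  refine (mul_le_mul_of_nonneg_left (hq.norm_pow_le hz three_pos) h0.le).trans (le_of_eq ?_)
  field_simp

lemma norm_exp_smul_sq_sub_le (hq : IsPseudoResolvent q C) {t : ℝ} {z : ℂ} (hz : 0 < z.re) :
    ‖exp (t * z) • (q z ^ 2 - z • q z ^ 3)‖ ≤
      Real.exp (t * z.re) * (C ^ 2 + C ^ 3) / ‖z‖ ^ 2 := by
  rw [norm_smul, norm_exp_mul, mul_div_assoc]
  exact mul_le_mul_of_nonneg_left (hq.norm_sq_sub_le hz) (Real.exp_pos _).le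

lemma integrable_cube (hq : IsPseudoResolvent q C) {t h : ℝ} (ht : 0 ≤ t) (hh : 0 < h) :
    Integrable fun y : ℝ => exp (t * ((h : ℂ) + y * I)) • q (h + y * I) ^ 3 :=
  integrable_vertical (g := fun z => exp (t * z) • q z ^ 3) hh
    (continuous_vertical_comp (fun z hz => (hq.differentiableAt_exp_smul_pow t 3 hz).continuousAt) hh)
    fun y => hq.norm_exp_smul_cube_le ht hh (by simp) (by simp : _ ≤ h)

lemma integrable_sq (hq : IsPseudoResolvent q C) {t h : ℝ} (hh : 0 < h) :
    Integrable fun y : ℝ => exp (t * ((h : ℂ) + y * I)) • q (h + y * I) ^ 2 :=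
  integrable_vertical (g := fun z => exp (t * z) • q z ^ 2) (M := Real.exp (t * h) * C ^ 2) hh
    (continuous_vertical_comp (fun z hz => (hq.differentiableAt_exp_smul_pow t 2 hz).continuousAt) hh)
    fun y => by simpa using hq.norm_exp_smul_sq_le (t := t) (z := h + y * I) (by simpa using hh)

lemma integrable_gen (hq : IsPseudoResolvent q C) {t h : ℝ} (hh : 0 < h) :
    Integrable fun y : ℝ => exp (t * ((h : ℂ) + y * I)) •
      (q (h + y * I) ^ 2 - ((h : ℂ) + y * I) • q (h + y * I) ^ 3) := by
  refine integrable_vertical (g := fun z => exp (t * z) • (q z ^ 2 - z • q z ^ 3))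
    (M := Real.exp (t * h) * (C ^ 2 + C ^ 3)) hh
    (continuous_vertical_comp (g := fun z => exp (t * z) • (q z ^ 2 - z • q z ^ 3)) (fun z hz => ?_) hh)
    fun y => by simpa using hq.norm_exp_smul_sq_sub_le (t := t) (z := h + y * I) (by simpa using hh)
  have := hq.continuousAt hz
  fun_prop

variable [CompleteSpace 𝓐]

/-- Independence of the vertical line for the integral defining the semigroup. -/
lemma verticalIntegral_cube_eq (hq : IsPseudoResolvent q C) {t a b : ℝ} (ht : 0 ≤ t) (ha : 0 < a)
    (hb : 0 < b) : verticalIntegral a (fun z => exp (t * z) • q z ^ 3) =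
      verticalIntegral b fun z => exp (t * z) • q z ^ 3 := by
  wlog hab : a < b generalizing a b
  · rcases (not_lt.1 hab).eq_or_lt with rfl | h
    · rfl
    · exact (this hb ha h).symm
  exact verticalIntegral_eq_of_lt ha hab (fun z hz => hq.differentiableAt_exp_smul_pow t 3 hz)
    fun z h1 h2 => hq.norm_exp_smul_cube_le ht ha h1 h2

lemma verticalIntegral_gen_eq (hq : IsPseudoResolvent q C) {t a b : ℝ} (ht : 0 ≤ t) (ha : 0 < a)
    (hb : 0 < b) : verticalIntegral a (fun z => exp (t * z) • (q z ^ 2 - z • q z ^ 3)) =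
      verticalIntegral b fun z => exp (t * z) • (q z ^ 2 - z • q z ^ 3) := by
  wlog hab : a < b generalizing a b
  · rcases (not_lt.1 hab).eq_or_lt with rfl | h
    · rfl
    · exact (this hb ha h).symm
  have hC := hq.nonneg
  refine verticalIntegral_eq_of_lt ha hab (M := Real.exp (t * b) * (C ^ 2 + C ^ 3)) (fun z hz => ?_)
    fun z h1 h2 => (hq.norm_exp_smul_sq_sub_le (ha.trans_le h1)).trans (by gcongr)
  have hd := (hq.hasDerivAt hz).differentiableAt
  exact DifferentiableAt.fun_smul (by fun_prop) ((hd.pow 2).sub (differentiableAt_id.smul (hd.pow 3)))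

/-- Freedom of the line: Re z = 1/t is best for norm bounds, while a line independent of t is needed
for differentiating in t. -/
lemma laplaceSemigroup_eq (hq : IsPseudoResolvent q C) {t h : ℝ} (ht : 0 < t) (hh : 0 < h) :
    laplaceSemigroup q t =
      ((Real.pi : ℂ) * t ^ 2)⁻¹ • verticalIntegral h fun z => exp (t * z) • q z ^ 3 := by
  rw [laplaceSemigroup, hq.verticalIntegral_cube_eq ht.le (inv_pos.2 ht) hh]

lemma laplaceSemigroupGen_eq (hq : IsPseudoResolvent q C) {t h : ℝ} (ht : 0 < t) (hh : 0 < h) :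
    laplaceSemigroupGen q t = ((Real.pi : ℂ) * t ^ 2)⁻¹ • verticalIntegral h fun z =>
      exp (t * z) • (q z ^ 2 - z • q z ^ 3) := by
  rw [laplaceSemigroupGen, hq.verticalIntegral_gen_eq ht.le (inv_pos.2 ht) hh]

/-- Integration by parts on a vertical line. -/
lemma smul_verticalIntegral_sq (hq : IsPseudoResolvent q C) (t : ℝ) {h : ℝ} (ht : 0 ≤ t) (hh : 0 < h) :
    (t : ℂ) • verticalIntegral h (fun z => exp (t * z) • q z ^ 2) =
      (2 : ℂ) • verticalIntegral h (fun z => exp (t * z) • q z ^ 3) := by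
  have hder : ∀ y : ℝ, HasDerivAt (fun y : ℝ => exp (t * ((h : ℂ) + y * I)) • q (h + y * I) ^ 2)
      (I • ((t : ℂ) • exp (t * ((h : ℂ) + y * I)) • q (h + y * I) ^ 2 -
        (2 : ℂ) • exp (t * ((h : ℂ) + y * I)) • q (h + y * I) ^ 3)) y := by
    intro y
    have hz : 0 < ((h : ℂ) + y * I).re := by simpa using hh
    have h1 : HasDerivAt (fun z : ℂ => exp (t * z)) (exp (t * ((h : ℂ) + y * I)) * t)
        ((h : ℂ) + y * I) := by
      simpa using ((hasDerivAt_id ((h : ℂ) + y * I)).const_mul (t : ℂ)).cexp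
    have h2 := h1.fun_smul (hq.hasDerivAt_sq hz)
    have h3 : HasDerivAt (fun y : ℝ => (h : ℂ) + y * I) I y := by
      simpa using ((hasDerivAt_id y).ofReal_comp.mul_const I).const_add (h : ℂ)
    refine (h2.scomp y h3).congr_deriv ?_
    congr 1
    module
  -- The boundary terms vanish at both ends, by the quadratic decay of q².
  have hlim : ∀ l : Filter ℝ, Tendsto (fun y : ℝ => |y|) l atTop →
      Tendsto (fun y : ℝ => exp (t * ((h : ℂ) + y * I)) • q (h + y * I) ^ 2) l (𝓝 0) := by
    intro l hl
    refine squeeze_zero_norm (fun y => ?_) (tendsto_const_div_vertical (Real.exp (t * h) * C ^ 2) h hl)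
    simpa using hq.norm_exp_smul_sq_le (t := t) (z := h + y * I) (by simpa using hh)
  have hi2 := (hq.integrable_sq (t := t) hh).fun_smul (t : ℂ)
  have hi3 := (hq.integrable_cube ht hh).fun_smul (2 : ℂ)
  have := integral_of_hasDerivAt_of_tendsto hder ((hi2.sub hi3).smul I)
    (hlim _ tendsto_abs_atBot_atTop) (hlim _ tendsto_abs_atTop_atTop)
  rw [integral_smul, sub_zero, smul_eq_zero, or_iff_right I_ne_zero, integral_sub hi2 hi3] at this
  rw [integral_smul, integral_smul] at this
  exact sub_eq_zero.1 this

end IsPseudoResolvent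

/-! ### Norm bounds and the differential equation. -/

namespace IsPseudoResolvent

open MeasureTheory Complex

variable {𝓐 : Type*} [NormedRing 𝓐] [NormedAlgebra ℂ 𝓐] {q : ℂ → 𝓐} {C : ℝ}

lemma norm_inv_pi_mul_sq (t : ℝ) : ‖((Real.pi : ℂ) * t ^ 2)⁻¹‖ = (Real.pi * t ^ 2)⁻¹ := by
  rw [norm_inv, norm_mul, norm_pow, norm_real, norm_real, Real.norm_eq_abs, Real.norm_eq_abs, sq_abs,
    abs_of_pos Real.pi_pos]

/-- The weight |z|⁻² has mass πt on Re z = 1/t; against the prefactor 1/(πt²) this leaves 1/t. -/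
lemma norm_smul_verticalIntegral_le {F : Type*} [NormedAddCommGroup F] [NormedSpace ℂ F] {t M : ℝ}
    (ht : 0 < t) {g : ℂ → F} (hg : ∀ z : ℂ, z.re = t⁻¹ → ‖g z‖ ≤ M / ‖z‖ ^ 2) :
    ‖((Real.pi : ℂ) * t ^ 2)⁻¹ • verticalIntegral t⁻¹ g‖ ≤ M / t := by
  rw [norm_smul, norm_inv_pi_mul_sq]
  have h1 : ‖verticalIntegral t⁻¹ g‖ ≤ M * (Real.pi / t⁻¹) :=
    norm_verticalIntegral_le (inv_pos.2 ht) fun y => hg _ (by simp)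
  refine (mul_le_mul_of_nonneg_left h1 (by positivity)).trans (le_of_eq ?_)
  have := Real.pi_pos.ne'
  field_simp

/-- On the line |e^{tz}| = e, and one of the three factors 1/|z| is at most t, which cancels the
1/t. -/
lemma norm_laplaceSemigroup_le (hq : IsPseudoResolvent q C) {t : ℝ} (ht : 0 < t) :
    ‖laplaceSemigroup q t‖ ≤ Real.exp 1 * C ^ 3 := by
  refine (norm_smul_verticalIntegral_le (M := Real.exp 1 * (C ^ 3 / t⁻¹)) ht fun z hz => ?_).trans
    (le_of_eq (by field_simp))
  have := hq.norm_exp_smul_cube_le ht.le (inv_pos.2 ht) hz.ge hz.le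
  rwa [mul_inv_cancel₀ ht.ne'] at this

/-- Here the integrand has only quadratic decay, so no factor is left to cancel 1/t. The smoothing
estimate thus follows from the half-plane bound alone. -/
lemma norm_laplaceSemigroupGen_le (hq : IsPseudoResolvent q C) {t : ℝ} (ht : 0 < t) :
    ‖laplaceSemigroupGen q t‖ ≤ Real.exp 1 * (C ^ 2 + C ^ 3) / t := by
  refine norm_smul_verticalIntegral_le ht fun z hz => ?_
  have := hq.norm_exp_smul_sq_sub_le (t := t) (z := z) (hz ▸ inv_pos.2 ht)
  rwa [hz, mul_inv_cancel₀ ht.ne'] at this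

lemma commute_verticalIntegral [CompleteSpace 𝓐] {h : ℝ} {g : ℂ → 𝓐} {a : 𝓐}
    (ha : ∀ z : ℂ, z.re = h → Commute a (g z)) (hg : Integrable fun y : ℝ => g (h + y * I)) :
    Commute a (verticalIntegral h g) := by
  rw [commute_iff_eq, verticalIntegral, ← integral_const_mul_of_integrable hg,
    ← integral_mul_const_of_integrable hg]
  exact integral_congr_ae (Eventually.of_forall fun y => ha _ (by simp))

/-- `(μ + G)⁻¹ (μ + G) e^{-tG} = e^{-tG}`. -/
lemma mul_laplaceSemigroup (hq : IsPseudoResolvent q C) {μ : ℂ} (hμ : 0 < μ.re) {t : ℝ} (ht : 0 < t) :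
    q μ * (μ • laplaceSemigroup q t + laplaceSemigroupGen q t) = laplaceSemigroup q t := by
  have hh := inv_pos.2 ht
  have h1 := hq.integrable_cube ht.le hh
  have h2 := hq.integrable_gen (t := t) hh
  rw [laplaceSemigroup, laplaceSemigroupGen, smul_comm μ, ← smul_add, mul_smul_comm]
  congr 1
  simp only [verticalIntegral]
  rw [← integral_smul, ← integral_add (h1.fun_smul μ) h2,
    ← integral_const_mul_of_integrable ((h1.fun_smul μ).fun_add h2)]
  refine integral_congr_ae (Eventually.of_forall fun y => ?_)
  have hz : 0 < ((t⁻¹ : ℝ) + y * I : ℂ).re := by simpa using ht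
  set z : ℂ := ((t⁻¹ : ℝ) + y * I : ℂ)
  -- This is (μ + G)⁻¹(μ + G) = 1 applied to q(z), with μ + G split as (μ - z) + (z + G).
  have h3 : q μ + (μ - z) • (q μ * q z) = q z := by
    have := hq.identity z μ hz hμ
    rw [(hq.commute hμ hz).eq, ← this]
    abel
  simp only
  rw [smul_comm μ, ← smul_add, mul_smul_comm]
  congr 1
  rw [add_sub, sub_eq_add_neg, add_comm (μ • _), add_assoc, ← sub_eq_add_neg, ← sub_smul, mul_add,
    pow_succ' _ 2, mul_smul_comm, ← mul_assoc, ← smul_mul_assoc, ← add_mul, h3]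

/-- Derivative in `t` of the defining integral. -/
lemma hasDerivAt_verticalIntegral_cube (hq : IsPseudoResolvent q C) {t : ℝ} (ht : 0 < t) :
    HasDerivAt (fun t : ℝ => verticalIntegral 1 fun z => exp (t * z) • q z ^ 3)
      (verticalIntegral 1 (fun z => exp (t * z) • q z ^ 2) -
        verticalIntegral 1 fun z => exp (t * z) • (q z ^ 2 - z • q z ^ 3)) t := by
  have hC := hq.nonneg
  have hz : ∀ y : ℝ, 0 < (((1 : ℝ) : ℂ) + y * I).re := fun y => by simp
  have hd := hasDerivAt_integral_of_dominated_loc_of_deriv_le (μ := (volume : Measure ℝ)) (x₀ := t)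
    (F := fun (t : ℝ) (y : ℝ) => exp (t * (((1 : ℝ) : ℂ) + y * I)) • q (((1 : ℝ) : ℂ) + y * I) ^ 3)
    (F' := fun (t : ℝ) (y : ℝ) => exp (t * (((1 : ℝ) : ℂ) + y * I)) •
      ((((1 : ℝ) : ℂ) + y * I) • q (((1 : ℝ) : ℂ) + y * I) ^ 3))
    (bound := fun y => Real.exp (t + 1) * C ^ 3 * (‖((1 : ℝ) : ℂ) + y * I‖ ^ 2)⁻¹)
    (s := Metric.ball t 1) (Metric.ball_mem_nhds t one_pos) ?_ (hq.integrable_cube ht.le one_pos) ?_ ?_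
    ((integrable_norm_vertical_sq_inv one_pos).const_mul _) ?_
  · refine hd.2.congr_deriv ?_
    simp only [verticalIntegral]
    rw [← integral_sub (hq.integrable_sq one_pos) (hq.integrable_gen one_pos)]
    refine integral_congr_ae (Eventually.of_forall fun y => ?_)
    simp only
    rw [← smul_sub, sub_sub_cancel]
  · refine Eventually.of_forall fun s => (continuous_vertical_comp
      (g := fun z => exp (s * z) • q z ^ 3) (fun z hz => ?_) one_pos).aestronglyMeasurable
    have := hq.continuousAt hz
    fun_prop
  · refine (continuous_vertical_comp
      (g := fun z => exp (t * z) • (z • q z ^ 3)) (fun z hz => ?_) one_pos).aestronglyMeasurable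
    have := hq.continuousAt hz
    fun_prop
  · refine Eventually.of_forall fun y s hs => ?_
    have h0 := norm_pos_of_re_pos (hz y)
    rw [norm_smul, norm_smul, norm_exp_mul, mul_assoc]
    have h1 : s ≤ t + 1 := by
      have := (abs_lt.1 (Metric.mem_ball.1 hs)).2
      linarith
    have h2 := mul_le_mul_of_nonneg_left (hq.norm_pow_le (hz y) three_pos) h0.le
    refine mul_le_mul ?_ (h2.trans (le_of_eq ?_)) (by positivity) (Real.exp_pos _).le
    · simpa using h1
    · field_simp
  · refine Eventually.of_forall fun y s _ => ?_
    rw [← smul_assoc]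
    refine HasDerivAt.smul_const ?_ _
    have : HasDerivAt (fun s : ℝ => (s : ℂ) * (((1 : ℝ) : ℂ) + y * I)) (((1 : ℝ) : ℂ) + y * I) s := by
      simpa using (hasDerivAt_id s).ofReal_comp.mul_const (((1 : ℝ) : ℂ) + y * I)
    exact this.cexp

variable [CompleteSpace 𝓐]

lemma commute_laplaceSemigroup_of_forall (hq : IsPseudoResolvent q C) {a : 𝓐} {t : ℝ} (ht : 0 < t)
    (ha : ∀ z : ℂ, 0 < z.re → Commute a (q z)) : Commute a (laplaceSemigroup q t) := by
  refine Commute.smul_right (commute_verticalIntegral (fun z hz => ?_)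
    (hq.integrable_cube ht.le (inv_pos.2 ht))) _
  exact ((ha z (hz ▸ inv_pos.2 ht)).pow_right 3).smul_right _

lemma commute_laplaceSemigroup (hq : IsPseudoResolvent q C) {z : ℂ} (hz : 0 < z.re) {t : ℝ}
    (ht : 0 < t) : Commute (q z) (laplaceSemigroup q t) :=
  hq.commute_laplaceSemigroup_of_forall ht fun _ hw => hq.commute hz hw

lemma laplaceSemigroup_commute (hq : IsPseudoResolvent q C) {s t : ℝ} (hs : 0 < s) (ht : 0 < t) :
    Commute (laplaceSemigroup q s) (laplaceSemigroup q t) :=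
  hq.commute_laplaceSemigroup_of_forall ht fun _ hw => (hq.commute_laplaceSemigroup hw hs).symm

/-- `d/dt e^{-tG} = -G e^{-tG}`. -/
theorem hasDerivAt_laplaceSemigroup (hq : IsPseudoResolvent q C) {t : ℝ} (ht : 0 < t) :
    HasDerivAt (laplaceSemigroup q) (-laplaceSemigroupGen q t) t := by
  have hpi : (Real.pi : ℂ) ≠ 0 := by exact_mod_cast Real.pi_ne_zero
  have ht' : (t : ℂ) ≠ 0 := by exact_mod_cast ht.ne'
  have h1 : HasDerivAt (fun t : ℝ => ((Real.pi : ℂ) * t ^ 2)⁻¹)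
      (-(2 * (Real.pi : ℂ)⁻¹ * ((t : ℂ) ^ 3)⁻¹)) t := by
    have h2 : HasDerivAt (fun t : ℝ => (Real.pi : ℂ) * (t : ℂ) ^ 2) (Real.pi * (2 * t)) t := by
      simpa using ((hasDerivAt_id t).ofReal_comp.fun_pow 2).const_mul (Real.pi : ℂ)
    refine (h2.fun_inv (by positivity)).congr_deriv ?_
    field_simp
  have h3 := h1.fun_smul (hq.hasDerivAt_verticalIntegral_cube ht)
  have h4 : (fun t : ℝ => ((Real.pi : ℂ) * t ^ 2)⁻¹ •
      verticalIntegral 1 fun z => exp (t * z) • q z ^ 3) =ᶠ[𝓝 t] laplaceSemigroup q := by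
    filter_upwards [lt_mem_nhds ht] with s hs
    exact (hq.laplaceSemigroup_eq hs one_pos).symm
  refine (h4.hasDerivAt_iff.1 h3).congr_deriv ?_
  -- The derivative of the prefactor 1/(πt²) produces a term in q³; integration by parts turns it
  -- into the q² term with opposite sign, so only the integral with G remains.
  have h5 := hq.smul_verticalIntegral_sq t ht.le one_pos
  rw [hq.laplaceSemigroupGen_eq ht one_pos, smul_sub]
  have h6 : (-(2 * (Real.pi : ℂ)⁻¹ * ((t : ℂ) ^ 3)⁻¹)) •
      verticalIntegral 1 (fun z => exp (t * z) • q z ^ 3) =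
      -(((Real.pi : ℂ) * t ^ 2)⁻¹ • verticalIntegral 1 (fun z => exp (t * z) • q z ^ 2)) := by
    rw [show (-(2 * (Real.pi : ℂ)⁻¹ * ((t : ℂ) ^ 3)⁻¹)) =
      -((Real.pi : ℂ)⁻¹ * ((t : ℂ) ^ 3)⁻¹) * 2 by ring, mul_smul, ← h5, smul_smul, ← neg_smul]
    congr 1
    field_simp
  rw [h6]
  abel

end IsPseudoResolvent

/-! ### Behaviour as t tends to 0 and the semigroup law. -/

namespace IsPseudoResolvent

open MeasureTheory Complex

variable {𝓐 : Type*} [NormedRing 𝓐] [NormedAlgebra ℂ 𝓐] {q : ℂ → 𝓐} {C : ℝ}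

lemma norm_smul_self_le (hq : IsPseudoResolvent q C) {z : ℂ} (hz : 0 < z.re) : ‖z • q z‖ ≤ C := by
  rw [norm_smul, mul_comm, ← le_div_iff₀ (norm_pos_of_re_pos hz)]
  exact hq.bound z hz

/-- `(z (z + G)⁻¹)³ (1 + G)⁻¹` tends to `(1 + G)⁻¹` at infinity, with a rate. -/
lemma norm_cube_mul_sub_le (hq : IsPseudoResolvent q C) {z : ℂ} (hz : 0 < z.re) :
    ‖q z ^ 3 * q 1 - (z ^ 3)⁻¹ • q 1‖ ≤ (1 + C + C ^ 2) * (C * C + C) / ‖z‖ ^ 4 := by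
  have hC := hq.nonneg
  have h0 := norm_pos_of_re_pos hz
  have h1 : (0 : ℝ) < (1 : ℂ).re := by simp
  set p := z • q z with hp
  set e := q z * q 1 - q z with he
  -- The resolvent identity between z and 1. Iterating it telescopes p³ q(1) - q(1) into e + pe +
  -- p²e, where p stays bounded and e is O(1/|z|).
  have hpq : p * q 1 = q 1 + e := by
    have := hq.identity z 1 hz h1
    rw [sub_smul, one_smul] at this
    rw [hp, smul_mul_assoc, he, ← sub_eq_zero, ← sub_eq_zero.2 this]
    abel
  have hpn : ‖p‖ ≤ C := hq.norm_smul_self_le hz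
  have hen : ‖e‖ ≤ (C * C + C) / ‖z‖ := by
    have hq1 : ‖q 1‖ ≤ C := by simpa using hq.bound 1 h1
    refine (norm_sub_le _ _).trans ?_
    rw [add_div]
    refine add_le_add ((norm_mul_le _ _).trans ?_) (hq.bound z hz)
    rw [mul_div_right_comm]
    exact mul_le_mul (hq.bound z hz) hq1 (norm_nonneg _) (by positivity)
  have hcube : z ^ 3 • (q z ^ 3 * q 1 - (z ^ 3)⁻¹ • q 1) = e + p * e + p * (p * e) := by
    have hz3 : z ^ 3 ≠ 0 := pow_ne_zero _ (ne_zero_of_re_pos hz)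
    rw [smul_sub, smul_inv_smul₀ hz3, ← smul_mul_assoc, ← smul_pow, ← hp, pow_succ, mul_assoc, hpq, mul_add,
      sq, mul_assoc, hpq, mul_add, hpq, mul_assoc]
    abel
  have hb : ‖e + p * e + p * (p * e)‖ ≤ (1 + C + C ^ 2) * ((C * C + C) / ‖z‖) := by
    have h2 : ‖p * e‖ ≤ C * ((C * C + C) / ‖z‖) :=
      (norm_mul_le _ _).trans (mul_le_mul hpn hen (norm_nonneg _) hC)
    have h3 : ‖p * (p * e)‖ ≤ C * (C * ((C * C + C) / ‖z‖)) :=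
      (norm_mul_le _ _).trans (mul_le_mul hpn h2 (norm_nonneg _) hC)
    refine (norm_add₃_le).trans ((add_le_add (add_le_add hen h2) h3).trans (le_of_eq (by ring)))
  rw [← hcube, norm_smul, norm_pow] at hb
  rw [le_div_iff₀ (by positivity)]
  calc _ = ‖z‖ * (‖z‖ ^ 3 * ‖q z ^ 3 * q 1 - (z ^ 3)⁻¹ • q 1‖) := by ring
    _ ≤ ‖z‖ * ((1 + C + C ^ 2) * ((C * C + C) / ‖z‖)) := by gcongr
    _ = _ := by field_simp

variable [CompleteSpace 𝓐]

/-- Strong continuity at `0`, on the range of `(1 + G)⁻¹`. -/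
lemma norm_laplaceSemigroup_mul_sub_le (hq : IsPseudoResolvent q C) {t : ℝ} (ht : 0 < t) :
    ‖laplaceSemigroup q t * q 1 - q 1‖ ≤
      Real.exp 1 * ((1 + C + C ^ 2) * (C * C + C)) * t := by
  have hC := hq.nonneg
  have hh := inv_pos.2 ht
  have hpi : (Real.pi : ℂ) ≠ 0 := by exact_mod_cast Real.pi_ne_zero
  have ht' : (t : ℂ) ≠ 0 := by exact_mod_cast ht.ne'
  have hI := hq.integrable_cube ht.le hh
  -- A non-integrable function would have integral 0 by convention, whereas the value is known to be
  -- πt² ≠ 0.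
  have hJ : Integrable fun y : ℝ => exp (t * ((t⁻¹ : ℝ) + y * I)) * (((t⁻¹ : ℝ) + y * I : ℂ) ^ 3)⁻¹ := by
    by_contra hn
    have := verticalIntegral_exp_mul_inv_cube hh ht
    rw [verticalIntegral, integral_undef hn] at this
    exact mul_ne_zero hpi (pow_ne_zero 2 ht') this.symm
  -- The constant 1 is replaced by its own inverse Laplace integral, so that the difference becomes
  -- one integral with decay |z|⁻⁴; on the line this gains a factor t².
  have hrep : laplaceSemigroup q t * q 1 - q 1 = ((Real.pi : ℂ) * t ^ 2)⁻¹ •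
      verticalIntegral t⁻¹ fun z => exp (t * z) • (q z ^ 3 * q 1 - (z ^ 3)⁻¹ • q 1) := by
    have h1 : q 1 = ((Real.pi : ℂ) * t ^ 2)⁻¹ •
        verticalIntegral t⁻¹ (fun z => exp (t * z) * (z ^ 3)⁻¹) • q 1 := by
      rw [verticalIntegral_exp_mul_inv_cube hh ht, inv_smul_smul₀ (by positivity)]
    conv_lhs => rw [h1]
    conv_lhs => enter [1, 2]; rw [← h1]
    rw [laplaceSemigroup, smul_mul_assoc, ← smul_sub]
    congr 1
    simp only [verticalIntegral]
    rw [← integral_mul_const_of_integrable hI, ← integral_smul_const,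
      ← integral_sub (hI.mul_const _) (hJ.smul_const _)]
    refine integral_congr_ae (Eventually.of_forall fun y => ?_)
    simp only
    rw [smul_mul_assoc, mul_smul, smul_sub]
  rw [hrep]
  refine (norm_smul_verticalIntegral_le (M := Real.exp 1 *
    ((1 + C + C ^ 2) * (C * C + C) * t ^ 2)) ht fun z hz => ?_).trans (le_of_eq (by field_simp))
  have hz0 : 0 < z.re := hz ▸ hh
  have hzt : 1 ≤ t * ‖z‖ := by
    have := re_le_norm z
    rw [hz] at this
    rwa [inv_le_iff_one_le_mul₀' ht] at this
  have h0 := norm_pos_of_re_pos hz0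
  rw [norm_smul, norm_exp_mul, hz, mul_inv_cancel₀ ht.ne', mul_div_assoc]
  refine mul_le_mul_of_nonneg_left ((hq.norm_cube_mul_sub_le hz0).trans ?_) (Real.exp_pos _).le
  rw [div_le_div_iff₀ (by positivity) (by positivity)]
  have h2 : ‖z‖ ^ 2 ≤ t ^ 2 * ‖z‖ ^ 4 := by
    have : 1 ≤ (t * ‖z‖) ^ 2 := one_le_pow₀ hzt
    nlinarith [sq_nonneg ‖z‖]
  calc _ ≤ (1 + C + C ^ 2) * (C * C + C) * (t ^ 2 * ‖z‖ ^ 4) := by gcongr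
    _ = _ := by ring

lemma tendsto_laplaceSemigroup_mul (hq : IsPseudoResolvent q C) :
    Tendsto (fun t => laplaceSemigroup q t * q 1) (𝓝[>] 0) (𝓝 (q 1)) := by
  rw [tendsto_iff_norm_sub_tendsto_zero]
  have : Tendsto (fun t : ℝ => Real.exp 1 * ((1 + C + C ^ 2) * (C * C + C)) * t) (𝓝[>] 0) (𝓝 0) := by
    refine Tendsto.mono_left ?_ nhdsWithin_le_nhds
    simpa using (tendsto_id (x := 𝓝 (0 : ℝ))).const_mul (Real.exp 1 * ((1 + C + C ^ 2) * (C * C + C)))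
  refine squeeze_zero' (Eventually.of_forall fun _ => norm_nonneg _) ?_ this
  filter_upwards [self_mem_nhdsWithin] with t ht using hq.norm_laplaceSemigroup_mul_sub_le ht

/-- Both sides stand for G e^{-tG} e^{-sG}. The identity is checked after multiplying by q(1) = (1 +
G)⁻¹, which removes G; `hinj` allows q(1) to be cancelled. -/
lemma gen_mul_laplaceSemigroup (hq : IsPseudoResolvent q C) (hinj : ∀ a : 𝓐, q 1 * a = 0 → a = 0)
    {s t : ℝ} (hs : 0 < s) (ht : 0 < t) : laplaceSemigroupGen q t * laplaceSemigroup q s =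
      laplaceSemigroup q t * laplaceSemigroupGen q s := by
  have h1 : (0 : ℝ) < (1 : ℂ).re := by simp
  have hkey : ∀ {t : ℝ}, 0 < t →
      q 1 * laplaceSemigroupGen q t = laplaceSemigroup q t - q 1 * laplaceSemigroup q t := by
    intro t ht
    have := hq.mul_laplaceSemigroup h1 ht
    rw [one_smul, mul_add] at this
    exact eq_sub_of_add_eq' this
  rw [← sub_eq_zero]
  apply hinj
  rw [mul_sub, ← mul_assoc, ← mul_assoc, hkey ht, (hq.commute_laplaceSemigroup h1 ht).eq, mul_assoc, hkey hs,
    sub_mul, mul_sub, mul_assoc, sub_self]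

/-- The semigroup law. -/
theorem laplaceSemigroup_add (hq : IsPseudoResolvent q C) (hinj : ∀ a : 𝓐, q 1 * a = 0 → a = 0)
    {s t : ℝ} (hs : 0 < s) (ht : 0 < t) :
    laplaceSemigroup q (s + t) = laplaceSemigroup q s * laplaceSemigroup q t := by
  have h1 : (0 : ℝ) < (1 : ℂ).re := by simp
  -- The product e^{-(t-r)G} e^{-(s+r)G} is constant in r; the law comes from r = 0 and the limit r
  -- ↑ t.
  have hder : ∀ r : ℝ, 0 ≤ r → r < t →
      HasDerivAt (fun r => laplaceSemigroup q (t - r) * laplaceSemigroup q (s + r)) 0 r := by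
    intro r h0 hr
    have hd1 : HasDerivAt (fun r => laplaceSemigroup q (t - r)) (laplaceSemigroupGen q (t - r)) r := by
      simpa using (hq.hasDerivAt_laplaceSemigroup (sub_pos.2 hr)).comp_const_sub t r
    have hd2 : HasDerivAt (fun r => laplaceSemigroup q (s + r)) (-laplaceSemigroupGen q (s + r)) r := by
      exact (hq.hasDerivAt_laplaceSemigroup (by linarith : 0 < s + r)).comp_const_add s r
    refine (hd1.mul hd2).congr_deriv ?_
    rw [hq.gen_mul_laplaceSemigroup hinj (by linarith) (sub_pos.2 hr), mul_neg, add_neg_cancel]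
  have hconst : ∀ r : ℝ, 0 ≤ r → r < t →
      laplaceSemigroup q (t - r) * laplaceSemigroup q (s + r) =
        laplaceSemigroup q t * laplaceSemigroup q s := by
    intro r h0 hr
    have := constant_of_has_deriv_right_zero (a := 0) (b := r)
      (f := fun r => laplaceSemigroup q (t - r) * laplaceSemigroup q (s + r))
      (fun x hx => (hder x hx.1 (hx.2.trans_lt hr)).continuousAt.continuousWithinAt)
      (fun x hx => (hder x hx.1 (hx.2.trans hr)).hasDerivWithinAt) r ⟨h0, le_rfl⟩
    simpa using this
  have hto : Tendsto (fun r => t - r) (𝓝[<] t) (𝓝[>] 0) := by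
    refine tendsto_nhdsWithin_iff.2 ⟨?_, ?_⟩
    · have : Tendsto (fun r => t - r) (𝓝 t) (𝓝 (t - t)) := (continuous_const.sub continuous_id).tendsto t
      rw [sub_self] at this
      exact this.mono_left nhdsWithin_le_nhds
    · filter_upwards [self_mem_nhdsWithin] with r hr using sub_pos.2 (mem_Iio.1 hr)
  have hcont : Tendsto (fun r => laplaceSemigroup q (s + r)) (𝓝[<] t)
      (𝓝 (laplaceSemigroup q (s + t))) := by
    have h2 := (hq.hasDerivAt_laplaceSemigroup (add_pos hs ht)).continuousAt
    have h3 : Tendsto (fun r => s + r) (𝓝[<] t) (𝓝 (s + t)) := by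
      exact ((continuous_const.add continuous_id).tendsto t).mono_left nhdsWithin_le_nhds
    exact h2.tendsto.comp h3
  -- The available norm limit of e^{-(t-r)G} includes the factor q(1), so the limit is taken with
  -- this factor and it is cancelled by `hinj`.
  have hlim := (hq.tendsto_laplaceSemigroup_mul.comp hto).mul hcont
  have hlim2 : Tendsto (fun _ : ℝ => q 1 * (laplaceSemigroup q t * laplaceSemigroup q s)) (𝓝[<] t)
      (𝓝 (q 1 * laplaceSemigroup q (s + t))) := by
    refine hlim.congr' ?_
    have : ∀ᶠ r in 𝓝[<] t, 0 < r := nhdsWithin_le_nhds (lt_mem_nhds ht)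
    filter_upwards [this, self_mem_nhdsWithin] with r hr1 hr2
    rw [← hconst r hr1.le hr2, ← mul_assoc, (hq.commute_laplaceSemigroup h1 (sub_pos.2 hr2)).eq]
    rfl
  have h4 := tendsto_nhds_unique hlim2 tendsto_const_nhds
  rw [(hq.laplaceSemigroup_commute hs ht).eq, ← sub_eq_zero]
  apply hinj
  rw [mul_sub, h4, sub_self]

end IsPseudoResolvent

/-! ### Resolvents of unbounded operators. -/

namespace LinearPMap

variable {E : Type*} [NormedAddCommGroup E] [NormedSpace ℂ E] {A : E →ₗ.[ℂ] E} {z w : ℂ}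
  {R S : E →L[ℂ] E}

lemma map_mk_eq {x y : E} (hx : x ∈ A.domain) (hxy : x = y) (hy : y ∈ A.domain) :
    A ⟨x, hx⟩ = A ⟨y, hy⟩ := by subst hxy; rfl

lemma IsResolventAt.mem_domain (hR : A.IsResolventAt z R) (x : E) : R x ∈ A.domain := (hR.1 x).1

lemma IsResolventAt.map_apply (hR : A.IsResolventAt z R) (x : E) (h : R x ∈ A.domain) :
    A ⟨R x, h⟩ = z • R x - x := by
  obtain ⟨_, h2⟩ := hR.1 x
  exact (sub_eq_of_eq_add (eq_add_of_sub_eq' h2)).symm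

lemma IsResolventAt.eq_resolvent (hR : A.IsResolventAt z R) : A.resolvent z = R := by
  have h : ∃ R : E →L[ℂ] E, A.IsResolventAt z R := ⟨R, hR⟩
  have hS : A.IsResolventAt z (A.resolvent z) := by
    rw [resolvent, dif_pos h]
    exact h.choose_spec
  ext x
  have h1 := hR.2 ⟨A.resolvent z x, hS.mem_domain x⟩
  rw [hS.map_apply, sub_sub_cancel] at h1
  exact h1.symm

lemma isResolventAt_resolvent (hz : z ∈ A.resolventSet) : A.IsResolventAt z (A.resolvent z) := by
  obtain ⟨R, hR⟩ := hz
  rwa [hR.eq_resolvent]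

/-- Apply R(z - A) = 1 to Sx and use A Sx = wSx - x. -/
lemma IsResolventAt.sub_eq (hR : A.IsResolventAt z R) (hS : A.IsResolventAt w S) :
    R - S = (w - z) • (R * S) := by
  ext x
  have h1 := hR.2 ⟨S x, hS.mem_domain x⟩
  rw [hS.map_apply] at h1
  change R (z • S x - (w • S x - x)) = S x at h1
  simp only [_root_.sub_apply, _root_.smul_apply,
    mul_apply_eq_comp]
  refine (congrArg (R x - ·) h1.symm).trans ?_
  rw [← _root_.map_sub R, ← _root_.map_smul R]
  congr 1
  module

/-- Neumann perturbation of a resolvent. -/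
lemma IsResolventAt.of_isUnit (hR : A.IsResolventAt z R) (hu : IsUnit (1 + (w - z) • R)) :
    A.IsResolventAt w (R * Ring.inverse (1 + (w - z) • R)) := by
  set U := 1 + (w - z) • R with hU
  have hUx : ∀ x, U x = x + (w - z) • R x := fun x => by simp [hU]
  refine ⟨fun x => ⟨hR.mem_domain _, ?_⟩, fun y => ?_⟩
  · have h1 : U (Ring.inverse U x) = x := by
      rw [← mul_apply_eq_comp, Ring.mul_inverse_cancel _ hu]; rfl
    simp only [mul_apply_eq_comp]
    rw [hR.map_apply]
    conv_rhs => rw [← h1, hUx]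
    module
  · have h1 : w • (y : E) - A y = U (z • (y : E) - A y) := by
      rw [hUx, hR.2]
      module
    rw [h1, mul_apply_eq_comp, ← mul_apply_eq_comp _ U,
      Ring.inverse_mul_cancel _ hu, one_apply_eq_self, hR.2]

lemma commute_resolvent (hz : z ∈ A.resolventSet) (hw : w ∈ A.resolventSet) :
    Commute (A.resolvent z) (A.resolvent w) := by
  rcases eq_or_ne z w with rfl | h
  · exact Commute.refl _
  · have h1 := (isResolventAt_resolvent hz).sub_eq (isResolventAt_resolvent hw)
    have h2 := (isResolventAt_resolvent hw).sub_eq (isResolventAt_resolvent hz)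
    refine smul_right_injective (E →L[ℂ] E) (sub_ne_zero.2 h.symm) ?_
    simp only
    rw [← h1, ← neg_sub z w, neg_smul, ← h2, neg_sub]

lemma eventually_isUnit [CompleteSpace E] (z : ℂ) (R : E →L[ℂ] E) :
    ∀ᶠ w in 𝓝 z, IsUnit (1 + (w - z) • R) := by
  have hc : ContinuousAt (fun w : ℂ => 1 + (w - z) • R) z := by fun_prop
  have h0 : 1 + (z - z) • R = 1 := by simp
  have : {x : E →L[ℂ] E | IsUnit x} ∈ 𝓝 (1 + (z - z) • R) := by
    rw [h0]; exact Units.isOpen.mem_nhds isUnit_one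
  exact hc this

lemma isOpen_resolventSet [CompleteSpace E] : IsOpen A.resolventSet := by
  rw [isOpen_iff_mem_nhds]
  rintro z ⟨R, hR⟩
  filter_upwards [eventually_isUnit z R] with w hw using ⟨_, hR.of_isUnit hw⟩

lemma isClosed_spectrum [CompleteSpace E] : _root_.IsClosed A.spectrum := isOpen_resolventSet.isClosed_compl

/-- Near z the resolvent is R times the inverse of an affine function of w that equals 1 at z. -/
lemma differentiableAt_resolvent [CompleteSpace E] (hz : z ∈ A.resolventSet) :
    DifferentiableAt ℂ A.resolvent z := by
  have hR := isResolventAt_resolvent hz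
  set R := A.resolvent z
  have h1 : DifferentiableAt ℂ (fun w : ℂ => R * Ring.inverse (1 + (w - z) • R)) z := by
    refine (differentiableAt_const R).mul ?_
    have h2 : DifferentiableAt ℂ (Ring.inverse : (E →L[ℂ] E) → E →L[ℂ] E) (1 + (z - z) • R) := by
      have : 1 + (z - z) • R = ((1 : (E →L[ℂ] E)ˣ) : E →L[ℂ] E) := by simp
      rw [this]
      exact differentiableAt_inverse (Units.isUnit _)
    exact h2.comp z (f := fun w : ℂ => 1 + (w - z) • R) (by fun_prop)
  refine h1.congr_of_eventuallyEq ?_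
  filter_upwards [eventually_isUnit z R] with w hw using (hR.of_isUnit hw).eq_resolvent

/-- A bounded operator that commutes with one resolvent of `A` commutes with `A`. -/
lemma IsResolventAt.commutesWith (hR : A.IsResolventAt z R) {T : E →L[ℂ] E} (hT : Commute T R) :
    A.CommutesWith T := by
  intro x
  have hx := hR.2 x
  have h1 : ∀ u, T (R u) = R (T u) := fun u => congrArg (fun S : E →L[ℂ] E => S u) hT.eq
  have h2 : T x = R (T (z • (x : E) - A x)) := by rw [← h1, hx]
  have hd : T x ∈ A.domain := by rw [h2]; exact hR.mem_domain _
  refine ⟨hd, ?_⟩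
  rw [map_mk_eq hd h2 (hR.mem_domain _), hR.map_apply, ← h2, _root_.map_sub, _root_.map_smul, sub_sub_cancel]

end LinearPMap

/-- Uniformly bounded operators that converge to the identity on a dense set do so everywhere. -/
lemma tendsto_apply_of_dense {X : Type*} [NormedAddCommGroup X] [NormedSpace ℂ X] {ι : Type*}
    {l : Filter ι} {T : ι → X →L[ℂ] X} {N : ℝ} {D : Set X} (hD : Dense D)
    (hN : ∀ᶠ i in l, ‖T i‖ ≤ N) (hT : ∀ x ∈ D, Tendsto (fun i => T i x) l (𝓝 x)) (x : X) :
    Tendsto (fun i => T i x) l (𝓝 x) := by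
  rw [Metric.tendsto_nhds]
  intro ε hε
  have hN' : 0 < |N| + 2 := by positivity
  obtain ⟨y, hy, hxy⟩ := Metric.dense_iff.1 hD x (ε / (|N| + 2)) (by positivity)
  have hy' : ‖x - y‖ < ε / (|N| + 2) := by rwa [Metric.mem_ball, dist_comm, dist_eq_norm] at hy
  filter_upwards [hN, Metric.tendsto_nhds.1 (hT y hxy) (ε / (|N| + 2)) (by positivity)] with i h1 h2
  rw [dist_eq_norm] at h2 ⊢
  have h3 : ‖T i (x - y)‖ ≤ |N| * ‖x - y‖ :=
    ((T i).le_opNorm _).trans (mul_le_mul_of_nonneg_right (h1.trans (le_abs_self N)) (norm_nonneg _))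
  calc ‖T i x - x‖ = ‖T i (x - y) + (T i y - y) + (y - x)‖ := by rw [map_sub]; congr 1; abel
    _ ≤ ‖T i (x - y)‖ + ‖T i y - y‖ + ‖y - x‖ := norm_add₃_le
    _ ≤ |N| * ‖x - y‖ + ‖T i y - y‖ + ‖x - y‖ := by rw [norm_sub_rev y x]; gcongr
    _ < |N| * (ε / (|N| + 2)) + ε / (|N| + 2) + ε / (|N| + 2) := by
      have := mul_le_mul_of_nonneg_left hy'.le (abs_nonneg N)
      linarith
    _ = ε := by field_simp; ring

/-! ### The semigroup generated under a half-plane resolvent bound. -/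

namespace LinearPMap

variable {X : Type*} [NormedAddCommGroup X] [NormedSpace ℂ X]

/-- The half-plane `Re z < δ` lies in the resolvent set of `B`, with `‖(z - B)⁻¹‖ ≤ C / |z - δ|`. -/
def HasHalfPlaneBound (B : X →ₗ.[ℂ] X) (δ C : ℝ) : Prop :=
  ∀ z : ℂ, z.re < δ → z ∈ B.resolventSet ∧ ‖B.resolvent z‖ ≤ C / ‖z - δ‖

/-- With G = B - δ one has -(δ - z - B)⁻¹ = (z + G)⁻¹, and Re z > 0 corresponds to Re (δ - z) < δ.
-/
lemma HasHalfPlaneBound.isPseudoResolvent {B : X →ₗ.[ℂ] X} {δ C : ℝ} (h : B.HasHalfPlaneBound δ C) :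
    IsPseudoResolvent (fun z => -B.resolvent (δ - z)) C where
  identity z w hz hw := by
    have h1 := isResolventAt_resolvent (h (δ - z) (by simpa using hz)).1
    have h2 := isResolventAt_resolvent (h (δ - w) (by simpa using hw)).1
    rw [neg_mul_neg, neg_sub_neg, h2.sub_eq h1, (commute_resolvent (h (δ - w) (by simpa using hw)).1 (h (δ - z) (by simpa using hz)).1).eq]
    congr 1
    ring
  bound z hz := by
    rw [norm_neg]
    refine (h (δ - z) (by simpa using hz)).2.trans (le_of_eq ?_)
    rw [sub_sub_cancel_left, norm_neg]

/-- The semigroup generated by `-B`, obtained from the semigroup of `B - δ`. -/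
def expSemigroup (B : X →ₗ.[ℂ] X) (δ : ℝ) (t : ℝ) : X →L[ℂ] X :=
  if 0 < t then (Real.exp (-δ * t) : ℂ) • laplaceSemigroup (fun z => -B.resolvent (δ - z)) t else 1

lemma expSemigroup_of_pos (B : X →ₗ.[ℂ] X) (δ : ℝ) {t : ℝ} (ht : 0 < t) : B.expSemigroup δ t =
    (Real.exp (-δ * t) : ℂ) • laplaceSemigroup (fun z => -B.resolvent (δ - z)) t := if_pos ht

lemma expSemigroup_zero (B : X →ₗ.[ℂ] X) (δ : ℝ) : B.expSemigroup δ 0 = 1 := if_neg (lt_irrefl 0)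

lemma norm_exp_smul {Y : Type*} [SeminormedAddCommGroup Y] [NormedSpace ℂ Y] (r : ℝ) (y : Y) :
    ‖(Real.exp r : ℂ) • y‖ = Real.exp r * ‖y‖ := by
  rw [norm_smul, Complex.norm_of_nonneg (Real.exp_pos r).le]

lemma IsResolventAt.eq_zero_of_apply_eq_zero {B : X →ₗ.[ℂ] X} {z : ℂ} {R : X →L[ℂ] X}
    (hR : B.IsResolventAt z R) {x : X} (hx : R x = 0) : x = 0 := by
  have h1 := hR.map_apply x (hR.mem_domain x)
  rw [map_mk_eq _ hx B.domain.zero_mem, hx, smul_zero, zero_sub] at h1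
  have h2 : B ⟨0, B.domain.zero_mem⟩ = 0 := LinearPMap.map_zero B
  rw [h2] at h1
  exact neg_eq_zero.1 h1.symm

lemma neg_graph_iff {B : X →ₗ.[ℂ] X} {x y : X} :
    (x, y) ∈ (-B).graph ↔ ∃ h : x ∈ B.domain, B ⟨x, h⟩ = -y := by
  rw [mem_graph_iff]
  constructor
  · rintro ⟨⟨u, hu⟩, rfl, h2⟩
    refine ⟨hu, ?_⟩
    simp only [LinearPMap.neg_apply] at h2
    rw [← h2, neg_neg]
  · rintro ⟨hx, h2⟩
    refine ⟨⟨x, hx⟩, rfl, ?_⟩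
    rw [LinearPMap.neg_apply, h2, neg_neg]

variable {B : X →ₗ.[ℂ] X} {δ C : ℝ}

namespace HasHalfPlaneBound

lemma isResolventAt (h : B.HasHalfPlaneBound δ C) :
    B.IsResolventAt (δ - 1) (B.resolvent (δ - 1)) := isResolventAt_resolvent (h _ (by simp)).1

/-- Resolvents are injective; this is the cancellation hypothesis of the semigroup law. -/
lemma eq_zero_of_mul_eq_zero (h : B.HasHalfPlaneBound δ C) (a : X →L[ℂ] X)
    (ha : -B.resolvent (δ - 1) * a = 0) : a = 0 := by
  ext x
  have h1 : (-B.resolvent (δ - 1) * a) x = 0 := by rw [ha]; rfl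
  exact h.isResolventAt.eq_zero_of_apply_eq_zero (neg_eq_zero.1 h1)

lemma norm_expSemigroup_le (h : B.HasHalfPlaneBound δ C) {t : ℝ} (ht : 0 < t) :
    ‖B.expSemigroup δ t‖ ≤ Real.exp 1 * C ^ 3 * Real.exp (-δ * t) := by
  rw [expSemigroup_of_pos B δ ht, norm_smul, Complex.norm_of_nonneg (Real.exp_pos _).le, mul_comm]
  exact mul_le_mul_of_nonneg_right (h.isPseudoResolvent.norm_laplaceSemigroup_le ht)
    (Real.exp_pos _).le

/-- The semigroup maps into the domain of `B`. -/
lemma map_expSemigroup (h : B.HasHalfPlaneBound δ C) {t : ℝ} (ht : 0 < t) (x : X) :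
    ∃ hd : B.expSemigroup δ t x ∈ B.domain, B ⟨B.expSemigroup δ t x, hd⟩ =
      (Real.exp (-δ * t) : ℂ) • (laplaceSemigroupGen (fun z => -B.resolvent (δ - z)) t x +
        (δ : ℂ) • laplaceSemigroup (fun z => -B.resolvent (δ - z)) t x) := by
  have hq := h.isPseudoResolvent
  have h1 := hq.mul_laplaceSemigroup (μ := 1) (by simp) ht
  set S := laplaceSemigroup (fun z => -B.resolvent (δ - z)) t with hS
  set V := laplaceSemigroupGen (fun z => -B.resolvent (δ - z)) t with hV
  have h2 : S x = B.resolvent (δ - 1) (-(S x + V x)) := by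
    conv_lhs => rw [← h1]
    simp
  have h3 : B.expSemigroup δ t x =
      B.resolvent (δ - 1) ((Real.exp (-δ * t) : ℂ) • (-(S x + V x))) := by
    rw [expSemigroup_of_pos B δ ht, _root_.map_smul, ← h2]
    rfl
  have hd := h.isResolventAt.mem_domain ((Real.exp (-δ * t) : ℂ) • (-(S x + V x)))
  refine ⟨h3 ▸ hd, ?_⟩
  rw [map_mk_eq _ h3 hd, h.isResolventAt.map_apply, _root_.map_smul, ← h2]
  module

/-- B e^{-tB} = e^{-δt}(G + δ)e^{-tG}. Half of the exponential absorbs the term with δ, since δ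
e^{-δt/2} ≤ 2/t; hence the rate δ/2 and the constant (C² + C³) + 2C³. -/
lemma norm_map_expSemigroup_le (h : B.HasHalfPlaneBound δ C) (hδ : 0 < δ) {t : ℝ} (ht : 0 < t) (x : X) :
    ∃ hd : B.expSemigroup δ t x ∈ B.domain, ‖B ⟨B.expSemigroup δ t x, hd⟩‖ ≤
      Real.exp 1 * (C ^ 2 + 3 * C ^ 3) * t⁻¹ * Real.exp (-(δ / 2) * t) * ‖x‖ := by
  obtain ⟨hd, he⟩ := h.map_expSemigroup ht x
  have hq := h.isPseudoResolvent
  have hC := hq.nonneg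
  refine ⟨hd, ?_⟩
  rw [he, norm_exp_smul]
  have h1 := (ContinuousLinearMap.le_opNorm (laplaceSemigroupGen (fun z => -B.resolvent (δ - z)) t) x).trans
    (mul_le_mul_of_nonneg_right (hq.norm_laplaceSemigroupGen_le ht) (norm_nonneg x))
  have h2 := (ContinuousLinearMap.le_opNorm (laplaceSemigroup (fun z => -B.resolvent (δ - z)) t) x).trans
    (mul_le_mul_of_nonneg_right (hq.norm_laplaceSemigroup_le ht) (norm_nonneg x))
  have h3 : Real.exp (-δ * t) = Real.exp (-(δ / 2) * t) * Real.exp (-(δ / 2) * t) := by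
    rw [← Real.exp_add]; congr 1; ring
  have h4 : δ * t * Real.exp (-(δ / 2) * t) ≤ 2 := by
    have h5 := Real.add_one_le_exp (δ / 2 * t)
    rw [neg_mul, Real.exp_neg, ← div_eq_mul_inv, div_le_iff₀ (Real.exp_pos _)]
    linarith
  have h5 : Real.exp (-(δ / 2) * t) ≤ 1 := Real.exp_le_one_iff.2 (by
    have := mul_pos hδ ht
    linarith)
  have h6 := Real.exp_pos (-(δ / 2) * t)
  have h7 := Real.exp_pos 1
  set ε := Real.exp (-(δ / 2) * t)
  refine (mul_le_mul_of_nonneg_left ((norm_add_le _ _).trans (add_le_add h1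
    ((norm_smul _ _).le.trans (mul_le_mul_of_nonneg_left h2 (norm_nonneg _))))) (Real.exp_pos _).le).trans ?_
  rw [h3, Complex.norm_of_nonneg hδ.le]
  have h8 : ε * δ ≤ 2 * t⁻¹ := by
    rw [← div_eq_mul_inv, le_div_iff₀ ht]
    linarith
  calc ε * ε * (Real.exp 1 * (C ^ 2 + C ^ 3) / t * ‖x‖ + δ * (Real.exp 1 * C ^ 3 * ‖x‖))
      = ε * Real.exp 1 * ‖x‖ * (ε * ((C ^ 2 + C ^ 3) * t⁻¹) + (ε * δ) * C ^ 3) := by ring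
    _ ≤ ε * Real.exp 1 * ‖x‖ * (1 * ((C ^ 2 + C ^ 3) * t⁻¹) + (2 * t⁻¹) * C ^ 3) := by gcongr
    _ = _ := by ring

variable [CompleteSpace X]

lemma commute_expSemigroup (h : B.HasHalfPlaneBound δ C) {t : ℝ} (ht : 0 < t) :
    Commute (B.expSemigroup δ t) (B.resolvent (δ - 1)) := by
  have h1 := h.isPseudoResolvent.commute_laplaceSemigroup (z := 1) (by simp) ht
  rw [expSemigroup_of_pos B δ ht]
  simpa using (h1.symm.neg_right).smul_left (Real.exp (-δ * t) : ℂ)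

/-- The generator is moved inside, onto x, so that strong continuity controls the derivative as t
tends to 0. -/
lemma hasDerivAt_expSemigroup (h : B.HasHalfPlaneBound δ C) {t : ℝ} (ht : 0 < t) {x : X}
    (hx : x ∈ B.domain) :
    HasDerivAt (fun t => B.expSemigroup δ t x) (B.expSemigroup δ t (-B ⟨x, hx⟩)) t := by
  have hq := h.isPseudoResolvent
  have h1 : HasDerivAt (fun t : ℝ => (Real.exp (-δ * t) : ℂ)) ((Real.exp (-δ * t) * -δ : ℝ) : ℂ) t := by
    have : HasDerivAt (fun t : ℝ => -δ * t) (-δ) t := by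
      simpa using (hasDerivAt_id t).const_mul (-δ)
    exact this.exp.ofReal_comp
  have h2 := h1.fun_smul (hq.hasDerivAt_laplaceSemigroup ht)
  have h3 := ((ContinuousLinearMap.apply ℂ X x).restrictScalars ℝ).hasFDerivAt.comp_hasDerivAt t h2
  have h4 : (fun t : ℝ => ((Real.exp (-δ * t) : ℂ) •
      laplaceSemigroup (fun z => -B.resolvent (δ - z)) t) x) =ᶠ[𝓝 t]
      fun t => B.expSemigroup δ t x := by
    filter_upwards [lt_mem_nhds ht] with s hs
    rw [expSemigroup_of_pos B δ hs]
  refine (h4.hasDerivAt_iff.1 h3).congr_deriv ?_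
  obtain ⟨hd, he⟩ := h.map_expSemigroup ht x
  obtain ⟨hd', he'⟩ := h.isResolventAt.commutesWith (h.commute_expSemigroup ht) ⟨x, hx⟩
  rw [_root_.map_neg, ← he', he]
  simp only [ContinuousLinearMap.coe_restrictScalars', ContinuousLinearMap.apply_apply, _root_.add_apply,
    _root_.smul_apply, _root_.neg_apply]
  push_cast
  module

lemma tendsto_expSemigroup (h : B.HasHalfPlaneBound δ C) (hd : Dense (B.domain : Set X)) (x : X) :
    Tendsto (fun t => B.expSemigroup δ t x) (𝓝[>] 0) (𝓝 x) := by
  have hq := h.isPseudoResolvent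
  have hexp : Tendsto (fun t : ℝ => Real.exp (-δ * t)) (𝓝[>] 0) (𝓝 1) := by
    have : Continuous fun t : ℝ => Real.exp (-δ * t) := by fun_prop
    simpa using (this.tendsto 0).mono_left nhdsWithin_le_nhds
  refine tendsto_apply_of_dense (N := Real.exp 1 * C ^ 3 * 2) hd ?_ (fun y hy => ?_) x
  · filter_upwards [self_mem_nhdsWithin, hexp.eventually (ge_mem_nhds one_lt_two)] with t ht h2
    have := hq.nonneg
    exact (h.norm_expSemigroup_le ht).trans (by gcongr)
  · have h1 := hq.tendsto_laplaceSemigroup_mul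
    have h2 : Tendsto (fun t : ℝ => (Real.exp (-δ * t) : ℂ) •
        (laplaceSemigroup (fun z => -B.resolvent (δ - z)) t * -B.resolvent (δ - 1)))
        (𝓝[>] 0) (𝓝 ((1 : ℂ) • (-B.resolvent (δ - 1)))) :=
      ((Complex.continuous_ofReal.tendsto 1).comp hexp).smul h1
    have h3 := ((ContinuousLinearMap.apply ℂ X
      (-(((δ : ℂ) - 1) • y - B ⟨y, hy⟩))).continuous.tendsto _).comp h2
    have h4 : B.resolvent (δ - 1) (((δ : ℂ) - 1) • y - B ⟨y, hy⟩) = y := h.isResolventAt.2 ⟨y, hy⟩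
    have h5 : (ContinuousLinearMap.apply ℂ X (-(((δ : ℂ) - 1) • y - B ⟨y, hy⟩)))
        ((1 : ℂ) • (-B.resolvent (δ - 1))) = y := by
      simp only [ContinuousLinearMap.apply_apply, one_smul, _root_.neg_apply, _root_.map_neg, neg_neg]
      exact h4
    rw [h5] at h3
    refine h3.congr' ?_
    filter_upwards [self_mem_nhdsWithin] with t ht
    rw [expSemigroup_of_pos B δ ht]
    simp only [Function.comp, ContinuousLinearMap.apply_apply, _root_.smul_apply, mul_apply_eq_comp,
      _root_.neg_apply, _root_.map_neg]
    rw [h4, smul_neg, neg_neg]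

lemma isC0Semigroup (h : B.HasHalfPlaneBound δ C) (hd : Dense (B.domain : Set X)) :
    IsC0Semigroup (B.expSemigroup δ) where
  zero := expSemigroup_zero B δ
  add s t hs ht := by
    rcases hs.eq_or_lt with rfl | hs
    · rw [expSemigroup_zero, zero_add, one_mul]
    rcases ht.eq_or_lt with rfl | ht
    · rw [expSemigroup_zero, add_zero, mul_one]
    rw [expSemigroup_of_pos B δ hs, expSemigroup_of_pos B δ ht, expSemigroup_of_pos B δ (add_pos hs ht),
      h.isPseudoResolvent.laplaceSemigroup_add h.eq_zero_of_mul_eq_zero hs ht, smul_mul_smul_comm,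
      ← Complex.ofReal_mul, ← Real.exp_add, mul_add]
  tendsto := h.tendsto_expSemigroup hd

/-- The derivative for t > 0 tends to -Bx, and the orbit is continuous at 0, so the one-sided
derivative at 0 exists with this value. -/
lemma tendsto_slope_expSemigroup (h : B.HasHalfPlaneBound δ C) (hd : Dense (B.domain : Set X)) {x : X}
    (hx : x ∈ B.domain) :
    Tendsto (fun t : ℝ => ((t⁻¹ : ℝ) : ℂ) • (B.expSemigroup δ t x - x)) (𝓝[>] 0)
      (𝓝 (-B ⟨x, hx⟩)) := by
  have h1 : HasDerivWithinAt (fun t => B.expSemigroup δ t x) (-B ⟨x, hx⟩) (Ici 0) 0 := by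
    refine hasDerivWithinAt_Ici_of_tendsto_deriv (s := Ioi 0)
      (fun t ht => (h.hasDerivAt_expSemigroup ht hx).differentiableAt.differentiableWithinAt) ?_
      self_mem_nhdsWithin ?_
    · rw [ContinuousWithinAt, expSemigroup_zero]
      exact h.tendsto_expSemigroup hd x
    · refine (h.tendsto_expSemigroup hd (-B ⟨x, hx⟩)).congr' ?_
      filter_upwards [self_mem_nhdsWithin] with t ht
      exact (h.hasDerivAt_expSemigroup ht hx).deriv.symm
  have h2 := (hasDerivWithinAt_iff_tendsto_slope' (self_notMem_Ioi)).1 (h1.mono Ioi_subset_Ici_self)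
  refine h2.congr fun t => ?_
  rw [slope_def_module, sub_zero, expSemigroup_zero, one_apply_eq_self, Complex.coe_smul]

/-- Under a half-plane resolvent bound, `-B` generates the semigroup `expSemigroup`. -/
theorem isSemigroupGeneratedBy (h : B.HasHalfPlaneBound δ C) (hd : Dense (B.domain : Set X)) :
    IsSemigroupGeneratedBy (B.expSemigroup δ) (-B) := by
  refine ⟨h.isC0Semigroup hd, fun x y => ?_⟩
  rw [neg_graph_iff]
  constructor
  · rintro ⟨hx, hxy⟩
    simpa [hxy] using h.tendsto_slope_expSemigroup hd hx
  · intro hlim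
    have hR := h.isResolventAt
    set R := B.resolvent (δ - 1)
    have h1 := (R.continuous.tendsto y).comp hlim
    have h2 := h.tendsto_slope_expSemigroup hd (hR.mem_domain x)
    -- A resolvent R commutes with the semigroup, and Rx lies in the domain, so the slope at Rx has
    -- two expressions for its limit. The equation then exhibits x itself as a value of R.
    have h3 : R y = -B ⟨R x, hR.mem_domain x⟩ := by
      refine tendsto_nhds_unique (h1.congr' ?_) h2
      filter_upwards [self_mem_nhdsWithin] with t ht
      have := congrArg (fun S : X →L[ℂ] X => S x) (h.commute_expSemigroup ht).eq
      simp only [mul_apply_eq_comp] at this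
      simp only [Function.comp, _root_.map_smul, _root_.map_sub]
      exact congrArg (fun u => ((t⁻¹ : ℝ) : ℂ) • (u - R x)) this.symm
    rw [hR.map_apply] at h3
    have h4 : x = R (y + ((δ : ℂ) - 1) • x) := by
      rw [_root_.map_add, _root_.map_smul, h3]
      module
    refine ⟨h4 ▸ hR.mem_domain _, ?_⟩
    rw [map_mk_eq _ h4 (hR.mem_domain _), hR.map_apply, ← h4]
    module

end HasHalfPlaneBound

end LinearPMap

/-! ### Normalized circle integrals. -/

section CauchyIntegral

open MeasureTheory Complex Metric

variable {F G : Type*} [NormedAddCommGroup F] [NormedSpace ℂ F] [NormedAddCommGroup G]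
  [NormedSpace ℂ G] {c : ℂ} {r : ℝ}

/-- The normalized circle integral `(2πi)⁻¹ ∮ f(z) dz`. -/
def normCircleIntegral (c : ℂ) (r : ℝ) (f : ℂ → F) : F :=
  (2 * (Real.pi : ℂ) * I)⁻¹ • ∮ z in C(c, r), f z

lemma normCircleIntegral_congr (hr : 0 ≤ r) {f g : ℂ → F} (h : EqOn f g (sphere c r)) :
    normCircleIntegral c r f = normCircleIntegral c r g := by
  rw [normCircleIntegral, circleIntegral.integral_congr hr h, normCircleIntegral]

lemma normCircleIntegral_add (hr : 0 ≤ r) {f g : ℂ → F} (hf : ContinuousOn f (sphere c r))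
    (hg : ContinuousOn g (sphere c r)) : normCircleIntegral c r (fun z => f z + g z) =
      normCircleIntegral c r f + normCircleIntegral c r g := by
  rw [normCircleIntegral, circleIntegral.integral_add (hf.circleIntegrable hr) (hg.circleIntegrable hr),
    smul_add]
  rfl

lemma normCircleIntegral_sub (hr : 0 ≤ r) {f g : ℂ → F} (hf : ContinuousOn f (sphere c r))
    (hg : ContinuousOn g (sphere c r)) : normCircleIntegral c r (fun z => f z - g z) =
      normCircleIntegral c r f - normCircleIntegral c r g := by
  rw [normCircleIntegral, circleIntegral.integral_sub (hf.circleIntegrable hr) (hg.circleIntegrable hr),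
    smul_sub]
  rfl

lemma normCircleIntegral_smul (a : ℂ) (f : ℂ → F) :
    normCircleIntegral c r (fun z => a • f z) = a • normCircleIntegral c r f := by
  rw [normCircleIntegral, circleIntegral.integral_smul, smul_comm]
  rfl

lemma normCircleIntegral_smul_const [CompleteSpace F] (f : ℂ → ℂ) (a : F) :
    normCircleIntegral c r (fun z => f z • a) = normCircleIntegral c r f • a := by
  rw [normCircleIntegral, circleIntegral.integral_smul_const, smul_smul]
  rfl

lemma ContinuousLinearMap.normCircleIntegral_comp_comm [CompleteSpace F] [CompleteSpace G]
    (L : F →L[ℂ] G) (hr : 0 ≤ r) {f : ℂ → F} (hf : ContinuousOn f (sphere c r)) :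
    L (normCircleIntegral c r f) = normCircleIntegral c r fun z => L (f z) := by
  rw [normCircleIntegral, map_smul, normCircleIntegral, circleIntegral, circleIntegral,
    ← ContinuousLinearMap.intervalIntegral_comp_comm L (hf.circleIntegrable hr).out]
  simp only [map_smul]

lemma commute_normCircleIntegral {𝓐 : Type*} [NormedRing 𝓐] [NormedAlgebra ℂ 𝓐] [CompleteSpace 𝓐]
    (hr : 0 ≤ r) {f : ℂ → 𝓐} (hf : ContinuousOn f (sphere c r)) {a : 𝓐}
    (h : ∀ z ∈ sphere c r, Commute a (f z)) : Commute a (normCircleIntegral c r f) := by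
  have h1 := (ContinuousLinearMap.mul ℂ 𝓐 a).normCircleIntegral_comp_comm hr hf
  have h2 := ((ContinuousLinearMap.mul ℂ 𝓐).flip a).normCircleIntegral_comp_comm hr hf
  simp only [ContinuousLinearMap.mul_apply', ContinuousLinearMap.flip_apply] at h1 h2
  rw [commute_iff_eq, h1, h2]
  exact normCircleIntegral_congr hr fun z hz => h z hz

lemma normCircleIntegral_sub_inv_of_mem_ball {w : ℂ} (hw : w ∈ ball c r) :
    normCircleIntegral c r (fun z => (z - w)⁻¹) = 1 := by
  rw [normCircleIntegral, circleIntegral.integral_sub_inv_of_mem_ball hw, smul_eq_mul]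
  exact inv_mul_cancel₀ two_pi_I_ne_zero

lemma normCircleIntegral_eq_zero (hr : 0 ≤ r) {f : ℂ → F}
    (hf : ∀ z ∈ closedBall c r, DifferentiableAt ℂ f z) : normCircleIntegral c r f = 0 := by
  rw [normCircleIntegral, circleIntegral_eq_zero_of_differentiable_on_off_countable hr countable_empty
    (fun z hz => (hf z hz).continuousAt.continuousWithinAt)
    (fun z hz => hf z (ball_subset_closedBall hz.1)), smul_zero]

lemma normCircleIntegral_sub_inv_of_notMem {w : ℂ} (hr : 0 ≤ r) (hw : w ∉ closedBall c r) :
    normCircleIntegral c r (fun z => (z - w)⁻¹) = 0 :=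
  normCircleIntegral_eq_zero hr fun z hz => by
    have : z - w ≠ 0 := sub_ne_zero.2 fun h => hw (h ▸ hz)
    fun_prop (disch := assumption)

lemma norm_normCircleIntegral_le {M : ℝ} (hr : 0 ≤ r) {f : ℂ → F} (hf : ∀ z ∈ sphere c r, ‖f z‖ ≤ M) :
    ‖normCircleIntegral c r f‖ ≤ r * M :=
  circleIntegral.norm_two_pi_i_inv_smul_integral_le_of_norm_le_const hr hf

/-- Differentiation of `(2πi)⁻¹ ∮ e^{tz} f(z) dz` in `t`. -/
lemma hasDerivAt_normCircleIntegral_exp (hr : 0 ≤ r) {f : ℂ → F} (hf : ContinuousOn f (sphere c r)) (t : ℂ) :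
    HasDerivAt (fun t => normCircleIntegral c r fun z => exp (t * z) • f z)
      (normCircleIntegral c r fun z => exp (t * z) • z • f z) t := by
  refine HasDerivAt.const_smul _ ?_
  have hf' : Continuous fun θ => f (circleMap c r θ) :=
    hf.comp_continuous (continuous_circleMap c r) fun θ => circleMap_mem_sphere c hr θ
  have hm := continuous_circleMap c r
  have hd : Continuous (deriv (circleMap c r)) := by
    rw [show deriv (circleMap c r) = fun θ => circleMap 0 r θ * I from funext (deriv_circleMap c r)]
    fun_prop
  refine (intervalIntegral.hasDerivAt_integral_of_dominated_loc_of_deriv_le (μ := volume)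
    (a := 0) (b := 2 * Real.pi) (x₀ := t)
    (F := fun t θ => deriv (circleMap c r) θ • (exp (t * circleMap c r θ) • f (circleMap c r θ)))
    (F' := fun t θ => deriv (circleMap c r) θ •
      (exp (t * circleMap c r θ) • circleMap c r θ • f (circleMap c r θ)))
    (bound := fun θ => ‖deriv (circleMap c r) θ‖ * (Real.exp ((‖t‖ + 1) * ‖circleMap c r θ‖) *
      ‖circleMap c r θ • f (circleMap c r θ)‖))
    (ball_mem_nhds t one_pos) ?_ ?_ ?_ ?_ ?_ ?_).2
  · exact Eventually.of_forall fun s => Continuous.aestronglyMeasurable (hd.smul ((continuous_const.mul hm).cexp.smul hf'))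
  · exact Continuous.intervalIntegrable (hd.smul ((continuous_const.mul hm).cexp.smul hf')) _ _
  · exact Continuous.aestronglyMeasurable 
      (hd.smul ((continuous_const.mul hm).cexp.smul (hm.smul hf')))
  · refine Eventually.of_forall fun θ _ s hs => ?_
    rw [norm_smul, norm_smul (exp _)]
    gcongr
    refine (norm_exp_le_exp_norm _).trans (Real.exp_le_exp.2 ?_)
    rw [norm_mul]
    gcongr
    have h1 := norm_sub_norm_le s t
    rw [mem_ball, dist_eq_norm] at hs
    linarith
  · exact Continuous.intervalIntegrable (hd.norm.mul ((Real.continuous_exp.comp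
      (continuous_const.mul hm.norm)).mul (hm.smul hf').norm)) _ _
  · refine Eventually.of_forall fun θ _ s _ => ?_
    refine HasDerivAt.const_smul _ ?_
    rw [← smul_assoc, smul_eq_mul]
    refine HasDerivAt.smul_const ?_ _
    have : HasDerivAt (fun s : ℂ => s * circleMap c r θ) (circleMap c r θ) s := by
      simpa using (hasDerivAt_id s).mul_const (circleMap c r θ)
    exact this.cexp

end CauchyIntegral

/-! ### The exponential of a bounded element as a contour integral. -/

section ExpBound

open Complex Metric

variable {𝓐 : Type*} [NormedRing 𝓐] [NormedAlgebra ℂ 𝓐] [CompleteSpace 𝓐] {c : ℂ} {r : ℝ}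

/-- The Dunford integral for the exponential of a bounded element. -/
theorem exp_smul_eq_normCircleIntegral (hr : 0 ≤ r) {a : 𝓐} {R : ℂ → 𝓐}
    (hR : ContinuousOn R (sphere c r)) (ha : ∀ z ∈ sphere c r, z • R z - a * R z = 1)
    (h1 : normCircleIntegral c r R = 1) (t : ℂ) :
    NormedSpace.exp (t • a) = normCircleIntegral c r fun z => exp (t * z) • R z := by
  set U : ℂ → 𝓐 := fun t => normCircleIntegral c r fun z => exp (t * z) • R z with hU
  have hcont : ∀ t : ℂ, ContinuousOn (fun z => exp (t * z) • R z) (sphere c r) := fun t => by fun_prop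
  have hU' : ∀ t, HasDerivAt U (a * U t) t := by
    intro t
    refine (hasDerivAt_normCircleIntegral_exp hr hR t).congr_deriv ?_
    have h2 := (ContinuousLinearMap.mul ℂ 𝓐 a).normCircleIntegral_comp_comm hr (hcont t)
    simp only [ContinuousLinearMap.mul_apply'] at h2
    -- Since zR(z) - aR(z) = 1 on the circle and the integral of e^{tz} vanishes, the integral U
    -- satisfies U' = aU. With U(0) = 1, supplied by `h1`, uniqueness makes it the exponential.
    have h3 : normCircleIntegral c r (fun z => exp (t * z) • (1 : 𝓐)) = 0 :=
      normCircleIntegral_eq_zero hr fun z _ => by fun_prop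
    rw [hU, h2, ← sub_eq_zero, ← h3, ← normCircleIntegral_sub hr (by fun_prop) (by fun_prop)]
    refine normCircleIntegral_congr hr fun z hz => ?_
    rw [← ha z hz, mul_smul_comm, smul_sub]
  have hW : ∀ t, HasDerivAt (fun t : ℂ => NormedSpace.exp (t • (-a)) * U t) 0 t := by
    intro t
    have := (hasDerivAt_exp_smul_const (-a) t).mul (hU' t)
    refine this.congr_deriv ?_
    noncomm_ring
  have hconst := is_const_of_deriv_eq_zero (fun t => (hW t).differentiableAt) (fun t => (hW t).deriv) t 0
  have hU0 : U 0 = 1 := by simpa [hU] using h1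
  simp only [zero_smul, NormedSpace.exp_zero, hU0, one_mul] at hconst
  have hinv : NormedSpace.exp (t • a) * NormedSpace.exp (t • (-a)) = 1 := by
    have hc : Commute (t • a) (t • (-a)) := (((Commute.refl a).neg_right).smul_right t).smul_left t
    let _ := NormedAlgebra.restrictScalars ℚ ℂ 𝓐
    rw [← NormedSpace.exp_add_of_commute hc, smul_neg, add_neg_cancel, NormedSpace.exp_zero]
  calc NormedSpace.exp (t • a) = NormedSpace.exp (t • a) * (NormedSpace.exp (t • (-a)) * U t) := by
        rw [hconst, mul_one]
    _ = U t := by rw [← mul_assoc, hinv, one_mul]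

theorem exists_norm_exp_smul_le (hr : 0 ≤ r) {a : 𝓐} {R : ℂ → 𝓐}
    (hR : ContinuousOn R (sphere c r)) (ha : ∀ z ∈ sphere c r, z • R z - a * R z = 1)
    (h1 : normCircleIntegral c r R = 1) {b : ℝ} (hb : ∀ z ∈ sphere c r, z.re ≤ b) :
    ∃ N : ℝ, 0 ≤ N ∧ ∀ t : ℝ, 0 ≤ t → ‖NormedSpace.exp ((t : ℂ) • a)‖ ≤ N * Real.exp (b * t) := by
  obtain ⟨M, hM⟩ := (isCompact_sphere c r).exists_bound_of_continuousOn hR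
  refine ⟨r * |M|, by positivity, fun t ht => ?_⟩
  rw [exp_smul_eq_normCircleIntegral hr hR ha h1, mul_assoc]
  refine norm_normCircleIntegral_le hr fun z hz => ?_
  rw [norm_smul, norm_exp, mul_comm]
  have h2 : ((t : ℂ) * z).re ≤ b * t := by
    simpa [mul_comm] using mul_le_mul_of_nonneg_left (hb z hz) ht
  exact mul_le_mul ((hM z hz).trans (le_abs_self M)) (Real.exp_le_exp.2 h2) (Real.exp_pos _).le
    (abs_nonneg M)

end ExpBound

/-! ### Parts of an operator in the range of a projection. -/

namespace LinearPMap

open Metric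

variable {E : Type*} [NormedAddCommGroup E] [NormedSpace ℂ E]

section Part

variable {A : E →ₗ.[ℂ] E} {P Q K : E →L[ℂ] E} {w : ℂ}

lemma apply_of_mem_rangeOf (hP : P * P = P) (x : rangeOf P) : P (x : E) = x := by
  obtain ⟨_, y, rfl⟩ := x
  exact congrArg (fun S : E →L[ℂ] E => S y) hP

/-- `P` as a map onto its range. -/
def toRangeOf (P : E →L[ℂ] E) : E →L[ℂ] rangeOf P :=
  P.codRestrict (rangeOf P) fun x => ⟨x, rfl⟩

/-- The compression of an operator to the range of `P`. -/
def compress (P : E →L[ℂ] E) : (E →L[ℂ] E) →L[ℂ] (rangeOf P →L[ℂ] rangeOf P) :=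
  (ContinuousLinearMap.compL ℂ (rangeOf P) E (rangeOf P) (toRangeOf P)).comp
    ((ContinuousLinearMap.compL ℂ (rangeOf P) E E).flip (rangeOf P).subtypeL)

lemma coe_compress_apply (x : rangeOf P) : (compress P K x : E) = P (K x) := rfl

lemma compress_self (hP : P * P = P) : compress P P = 1 := by
  ext x
  rw [coe_compress_apply, apply_of_mem_rangeOf hP, apply_of_mem_rangeOf hP]
  rfl

lemma isClosed_rangeOf (hP : P * P = P) : _root_.IsClosed (rangeOf P : Set E) := by
  have : (rangeOf P : Set E) = {x | P x = x} := by
    ext x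
    refine ⟨fun hx => apply_of_mem_rangeOf hP ⟨x, hx⟩, fun hx => ⟨x, hx⟩⟩
  rw [this]
  exact isClosed_eq P.continuous continuous_id

lemma coe_part_apply (hP : P * P = P) (hPA : A.CommutesWith P) (x : (A.part P).domain)
    (h : ((x : rangeOf P) : E) ∈ A.domain) : ((A.part P x : rangeOf P) : E) = A ⟨(x : rangeOf P), h⟩ := by
  obtain ⟨h1, h2⟩ := hPA ⟨(x : rangeOf P), h⟩
  change P (A ⟨(x : rangeOf P), h⟩) = _
  rw [← h2]
  exact map_mk_eq h1 (apply_of_mem_rangeOf hP _) h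

lemma coe_part_mk (hP : P * P = P) (hPA : A.CommutesWith P) (x : rangeOf P)
    (h : (x : E) ∈ A.domain) (h' : x ∈ (A.part P).domain) :
    ((A.part P ⟨x, h'⟩ : rangeOf P) : E) = A ⟨x, h⟩ := coe_part_apply hP hPA ⟨x, h'⟩ h

lemma CommutesWith.one_sub (hPA : A.CommutesWith P) : A.CommutesWith (1 - P) := by
  intro x
  obtain ⟨h1, h2⟩ := hPA x
  refine ⟨A.domain.sub_mem x.2 h1, ?_⟩
  have h3 := A.map_sub x ⟨P x, h1⟩
  rw [h2] at h3
  exact h3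

/-- A local inverse of `w - A` on the range of `P` yields a resolvent of the part of `A`. -/
lemma isResolventAt_part (hP : P * P = P) (hPA : A.CommutesWith P) (hKA : A.CommutesWith K)
    (hK : ∀ x, P x = x → ∃ h : K x ∈ A.domain, w • K x - A ⟨K x, h⟩ = x) :
    (A.part P).IsResolventAt w (compress P K) := by
  refine ⟨fun x => ?_, fun y => ?_⟩
  · have hx := apply_of_mem_rangeOf hP x
    obtain ⟨h1, h2⟩ := hK x hx
    obtain ⟨h3, h4⟩ := hPA ⟨K x, h1⟩
    refine ⟨h3, ?_⟩
    ext
    have h5 : ((A.part P ⟨compress P K x, h3⟩ : rangeOf P) : E) = P (A ⟨K x, h1⟩) :=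
      (coe_part_mk hP hPA (compress P K x) h3 h3).trans h4
    change w • P (K x) - ((A.part P ⟨compress P K x, h3⟩ : rangeOf P) : E) = x
    rw [h5, ← _root_.map_smul, ← _root_.map_sub, h2, hx]
  · have hy := apply_of_mem_rangeOf hP (y : rangeOf P)
    obtain ⟨h1, h2⟩ := hK _ hy
    obtain ⟨h3, h4⟩ := hKA ⟨((y : rangeOf P) : E), y.2⟩
    ext
    rw [coe_compress_apply, Submodule.coe_sub, coe_part_apply hP hPA _ y.2, Submodule.coe_smul,
      _root_.map_sub K, _root_.map_smul K, ← h4, h2, hy]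

/-- Resolvents of `A` restrict to resolvents of its part. -/
lemma IsResolventAt.part {R : E →L[ℂ] E} (hR : A.IsResolventAt w R) (hP : P * P = P)
    (hPR : Commute P R) : (A.part P).IsResolventAt w (compress P R) :=
  isResolventAt_part hP (hR.commutesWith hPR) (hR.commutesWith (Commute.refl R))
    fun x _ => ⟨hR.mem_domain x, by rw [hR.map_apply, sub_sub_cancel]⟩

/-- On the range P K x = K P x = K x, so ‖P‖ does not enter and the sectorial constants carry over
to the part unchanged. -/
lemma norm_compress_le (hP : P * P = P) (hPK : Commute P K) : ‖compress P K‖ ≤ ‖K‖ := by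
  refine ContinuousLinearMap.opNorm_le_bound _ (norm_nonneg K) fun x => ?_
  change ‖P (K x)‖ ≤ ‖K‖ * ‖(x : E)‖
  have h1 : P (K x) = K (P x) := congrArg (fun S : E →L[ℂ] E => S x) hPK.eq
  rw [h1, apply_of_mem_rangeOf hP]
  exact K.le_opNorm _

/-- The resolvent set of `A` contains the common part of the resolvent sets of two complementary
parts. -/
lemma mem_resolventSet_of_parts (hP : P * P = P) (hQ : Q * Q = Q) (hPQ : P + Q = 1)
    (hPA : A.CommutesWith P) (hQA : A.CommutesWith Q) (h1 : w ∈ (A.part P).resolventSet)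
    (h2 : w ∈ (A.part Q).resolventSet) : w ∈ A.resolventSet := by
  obtain ⟨R, hR⟩ := h1
  obtain ⟨S, hS⟩ := h2
  have hsum : ∀ x, P x + Q x = x := fun x => congrArg (fun T : E →L[ℂ] E => T x) hPQ
  have hadd : ∀ x y (hx : x ∈ A.domain) (hy : y ∈ A.domain),
      A ⟨x + y, A.domain.add_mem hx hy⟩ = A ⟨x, hx⟩ + A ⟨y, hy⟩ :=
    fun x y hx hy => A.map_add ⟨x, hx⟩ ⟨y, hy⟩
  have key : ∀ {P : E →L[ℂ] E} {R : rangeOf P →L[ℂ] rangeOf P}, P * P = P → A.CommutesWith P →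
      (A.part P).IsResolventAt w R →
      (∀ x, ∃ h : (R (toRangeOf P x) : E) ∈ A.domain,
        w • (R (toRangeOf P x) : E) - A ⟨R (toRangeOf P x), h⟩ = P x) ∧
      ∀ y : A.domain, (R (toRangeOf P (w • (y : E) - A y)) : E) = P y := by
    intro P R hP hPA hR
    refine ⟨fun x => ?_, fun y => ?_⟩
    · obtain ⟨h3, h4⟩ := hR.1 (toRangeOf P x)
      refine ⟨h3, ?_⟩
      have h5 := congrArg (Subtype.val) h4
      rw [Submodule.coe_sub, coe_part_mk hP hPA _ h3] at h5
      exact h5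
    · obtain ⟨h3, h4⟩ := hPA y
      have h5 := hR.2 ⟨toRangeOf P y, h3⟩
      have h6 : toRangeOf P (w • (y : E) - A y) =
          w • toRangeOf P (y : E) - A.part P ⟨toRangeOf P y, h3⟩ := by
        ext
        have h7 : ((A.part P ⟨toRangeOf P y, h3⟩ : rangeOf P) : E) = P (A y) :=
          (coe_part_mk hP hPA (toRangeOf P y) h3 h3).trans h4
        change P (w • (y : E) - A y) = w • P y - ((A.part P ⟨toRangeOf P y, h3⟩ : rangeOf P) : E)
        rw [h7, _root_.map_sub, _root_.map_smul]
      rw [h6]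
      exact congrArg Subtype.val h5
  obtain ⟨a1, a2⟩ := key hP hPA hR
  obtain ⟨b1, b2⟩ := key hQ hQA hS
  -- The resolvent is assembled as RP + SQ.
  refine ⟨(rangeOf P).subtypeL ∘L R ∘L toRangeOf P + (rangeOf Q).subtypeL ∘L S ∘L toRangeOf Q,
    fun x => ?_, fun y => ?_⟩
  · obtain ⟨h3, h4⟩ := a1 x
    obtain ⟨h5, h6⟩ := b1 x
    refine ⟨A.domain.add_mem h3 h5, ?_⟩
    refine Eq.trans ?_ (hsum x)
    rw [← h4, ← h6]
    refine (congrArg (_ - ·) (hadd _ _ h3 h5)).trans ?_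
    change w • ((R (toRangeOf P x) : E) + S (toRangeOf Q x)) - _ = _
    rw [smul_add]
    abel
  · refine Eq.trans ?_ (hsum y)
    rw [← a2 y, ← b2 y]
    rfl

/-- The part of a closed operator is closed. -/
lemma isClosed_part (hP : P * P = P) (hPA : A.CommutesWith P) (hA : A.IsClosed) :
    (A.part P).IsClosed := by
  have : ((A.part P).graph : Set (rangeOf P × rangeOf P)) =
      (fun p : rangeOf P × rangeOf P => ((p.1 : E), (p.2 : E))) ⁻¹' (A.graph : Set (E × E)) := by
    ext ⟨x, y⟩
    simp only [SetLike.mem_coe, mem_graph_iff, mem_preimage]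
    constructor
    · rintro ⟨u, rfl, rfl⟩
      exact ⟨⟨_, u.2⟩, rfl, (coe_part_apply hP hPA u u.2).symm⟩
    · rintro ⟨⟨u, hu⟩, h1, h2⟩
      simp only at h1 h2
      subst h1
      refine ⟨⟨x, hu⟩, rfl, ?_⟩
      ext
      rw [coe_part_apply hP hPA _ hu, ← h2]
  rw [LinearPMap.IsClosed, this]
  exact _root_.IsClosed.preimage (by fun_prop) hA

/-- P maps E continuously onto its range, hence the dense set D(A) onto a dense set, which lies in
D(A) again. -/
lemma dense_domain_part (hP : P * P = P) (hPA : A.CommutesWith P) (hA : Dense (A.domain : Set E)) :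
    Dense ((A.part P).domain : Set (rangeOf P)) := by
  have h1 : DenseRange (toRangeOf P) := Function.Surjective.denseRange fun x =>
    ⟨x, Subtype.ext (apply_of_mem_rangeOf hP x)⟩
  refine (h1.dense_image (toRangeOf P).continuous hA).mono ?_
  rintro _ ⟨x, hx, rfl⟩
  exact (hPA ⟨x, hx⟩).1

/-- The part of a sectorial operator in the range of a projection commuting with the resolvents is
sectorial. -/
lemma IsSectorial.part (hA : A.IsSectorial) (hP : P * P = P) (hPA : A.CommutesWith P)
    (hPR : ∀ z ∈ A.resolventSet, Commute P (A.resolvent z)) : (A.part P).IsSectorial := by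
  obtain ⟨hc, hd, a, φ, c, h0, h1, h2⟩ := hA
  refine ⟨isClosed_part hP hPA hc, dense_domain_part hP hPA hd, a, φ, c, h0, h1, fun z hz => ?_⟩
  obtain ⟨h3, h4⟩ := h2 z hz
  have h5 := (isResolventAt_resolvent h3).part hP (hPR z h3)
  refine ⟨⟨_, h5⟩, ?_⟩
  rw [h5.eq_resolvent]
  exact (norm_compress_le hP (hPR z h3)).trans h4

end Part

end LinearPMap

/-! ### Circles as cycles. -/

section CircleCycle

/-- The circle as a cycle parametrized by `[0, 1]`. -/
def circleCycle (c : ℂ) (r : ℝ) (_ : Fin 1) (t : ℝ) : ℂ := circleMap c r (2 * Real.pi * t)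

lemma isCycle_circleCycle (c : ℂ) (r : ℝ) : IsCycle (circleCycle c r) := fun _ =>
  ⟨(contDiff_circleMap c r).comp (contDiff_const.mul contDiff_id), by simp [circleCycle, circleMap]⟩

lemma cycleIntegral_circleCycle {F : Type*} [NormedAddCommGroup F] [NormedSpace ℂ F] (c : ℂ) (r : ℝ)
    (f : ℂ → F) : cycleIntegral (circleCycle c r) f = ∮ z in C(c, r), f z := by
  have hd : ∀ i t, deriv (circleCycle c r i) t =
      (2 * Real.pi : ℝ) • deriv (circleMap c r) (2 * Real.pi * t) := by
    intro i t
    have h1 : HasDerivAt (fun t : ℝ => 2 * Real.pi * t) (2 * Real.pi) t := by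
      simpa using (hasDerivAt_id t).const_mul (2 * Real.pi)
    have := HasDerivAt.scomp t (hasDerivAt_circleMap c r (2 * Real.pi * t)) h1
    rw [deriv_circleMap]
    exact this.deriv
  simp only [cycleIntegral, Finset.univ_unique, Finset.sum_singleton, hd, smul_assoc]
  rw [intervalIntegral.integral_smul]
  have := intervalIntegral.smul_integral_comp_mul_left (a := 0) (b := 1)
    (fun θ => deriv (circleMap c r) θ • f (circleMap c r θ)) (2 * Real.pi)
  rw [mul_zero, mul_one] at this
  exact this

end CircleCycle

/-! ### Riesz projections over a circle. -/

namespace LinearPMap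

open Metric

variable {E : Type*} [NormedAddCommGroup E] [NormedSpace ℂ E]

/-- The Riesz integral of the resolvent over a circle. -/
def rieszProj (A : E →ₗ.[ℂ] E) (c : ℂ) (r : ℝ) : E →L[ℂ] E := normCircleIntegral c r A.resolvent

/-- The Cauchy transform of the resolvent over a circle. -/
def cauchyResolvent (A : E →ₗ.[ℂ] E) (c : ℂ) (r : ℝ) (w : ℂ) : E →L[ℂ] E :=
  normCircleIntegral c r fun z => (z - w)⁻¹ • A.resolvent z

variable {A : E →ₗ.[ℂ] E} {c w μ : ℂ} {r : ℝ}

lemma isRieszIntegral_rieszProj (hr : 0 < r) (hs : sphere c r ⊆ A.resolventSet) {σ : Set ℂ}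
    (hσ : σ ⊆ ball c r) (hσ' : A.spectrum ∩ ball c r ⊆ σ) :
    A.IsRieszIntegral σ (A.rieszProj c r) := by
  have hwind : ∀ w, cycleWinding (circleCycle c r) w = normCircleIntegral c r fun z => (z - w)⁻¹ := by
    intro w
    rw [cycleWinding, cycleIntegral_circleCycle]
    rfl
  refine ⟨1, circleCycle c r, isCycle_circleCycle c r,
    fun i t _ => hs (circleMap_mem_sphere c hr.le _), fun w hw => ?_, fun w hw => ?_, ?_⟩
  · rw [hwind, normCircleIntegral_sub_inv_of_mem_ball (hσ hw)]
  · rw [hwind]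
    refine normCircleIntegral_sub_inv_of_notMem hr.le fun h => ?_
    rcases (mem_closedBall.1 h).lt_or_eq with h1 | h1
    · exact hw.2 (hσ' ⟨hw.1, h1⟩)
    · exact hw.1 (hs h1)
  · rw [cycleIntegral_circleCycle]
    rfl

lemma resolvent_eq_mul {z : ℂ} (hμ : μ ∈ A.resolventSet) (hz : z ∈ A.resolventSet) :
    A.resolvent z = A.resolvent μ * (1 + (μ - z) • A.resolvent z) := by
  have := (isResolventAt_resolvent hμ).sub_eq (isResolventAt_resolvent hz)
  rw [mul_add, mul_one, mul_smul_comm, ← neg_sub z μ, neg_smul, ← this]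
  abel

lemma one_sub_mul_self {P : E →L[ℂ] E} (hP : P * P = P) : (1 - P) * (1 - P) = 1 - P := by
  rw [mul_sub, mul_one, sub_mul, one_mul, hP, sub_self, sub_zero]

variable [CompleteSpace E]

lemma continuousOn_resolvent {s : Set ℂ} (hs : s ⊆ A.resolventSet) : ContinuousOn A.resolvent s :=
  fun _ hz => (differentiableAt_resolvent (hs hz)).continuousAt.continuousWithinAt

lemma commute_rieszProj (hr : 0 < r) (hs : sphere c r ⊆ A.resolventSet) (hμ : μ ∈ A.resolventSet) :
    Commute (A.rieszProj c r) (A.resolvent μ) :=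
  (commute_normCircleIntegral hr.le (continuousOn_resolvent hs)
    fun _ hz => commute_resolvent hμ (hs hz)).symm

lemma continuousOn_cauchyResolvent (hs : sphere c r ⊆ A.resolventSet) (hw : w ∉ sphere c r) :
    ContinuousOn (fun z => (z - w)⁻¹ • A.resolvent z) (sphere c r) :=
  ContinuousOn.smul (f := fun z => (z - w)⁻¹) (ContinuousOn.inv₀ (f := fun z => z - w) (by fun_prop)
    fun z hz => sub_ne_zero.2 fun h : z = w => hw (h ▸ hz)) (continuousOn_resolvent hs)

lemma commute_cauchyResolvent (hr : 0 < r) (hs : sphere c r ⊆ A.resolventSet) (hw : w ∉ sphere c r)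
    (hμ : μ ∈ A.resolventSet) : Commute (A.cauchyResolvent c r w) (A.resolvent μ) :=
  (commute_normCircleIntegral hr.le (continuousOn_cauchyResolvent hs hw)
    fun _ hz => (commute_resolvent hμ (hs hz)).smul_right _).symm

/-- The range of the Riesz projection lies in the range of the resolvent. -/
lemma exists_rieszProj_eq_mul (hr : 0 < r) (hs : sphere c r ⊆ A.resolventSet)
    (hμ : μ ∈ A.resolventSet) : ∃ L : E →L[ℂ] E, A.rieszProj c r = A.resolvent μ * L := by
  have hc := continuousOn_resolvent hs
  refine ⟨normCircleIntegral c r fun z => 1 + (μ - z) • A.resolvent z, ?_⟩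
  have h1 := (ContinuousLinearMap.mul ℂ (E →L[ℂ] E) (A.resolvent μ)).normCircleIntegral_comp_comm hr.le
    (f := fun z => 1 + (μ - z) • A.resolvent z) (c := c) (by fun_prop)
  simp only [ContinuousLinearMap.mul_apply'] at h1
  rw [h1]
  exact normCircleIntegral_congr hr.le fun z hz => resolvent_eq_mul hμ (hs hz)

/-- Multiply R(z) = R(μ)(1 + (μ - z)R(z)) by (z - w)⁻¹, use (μ - z)/(z - w) = (μ - w)/(z - w) - 1,
and integrate. With R(μ) factored out, all values lie in D(A) and A need not be taken under the
integral. -/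
lemma cauchyResolvent_eq_mul (hr : 0 < r) (hs : sphere c r ⊆ A.resolventSet) (hw : w ∉ sphere c r)
    (hμ : μ ∈ A.resolventSet) : A.cauchyResolvent c r w = A.resolvent μ *
      (normCircleIntegral c r (fun z => (z - w)⁻¹) • 1 + (μ - w) • A.cauchyResolvent c r w -
        A.rieszProj c r) := by
  have hc := continuousOn_resolvent hs
  have hne : ∀ z ∈ sphere c r, z - w ≠ 0 := fun _ hz => sub_ne_zero.2 fun h => hw (h ▸ hz)
  have hi : ContinuousOn (fun z => (z - w)⁻¹) (sphere c r) := ContinuousOn.inv₀ (by fun_prop) hne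
  have hg := continuousOn_cauchyResolvent hs hw
  have hi1 : ContinuousOn (fun z => (z - w)⁻¹ • (1 : E →L[ℂ] E)) (sphere c r) :=
    hi.smul continuousOn_const
  have hg1 : ContinuousOn (fun z => (μ - w) • (z - w)⁻¹ • A.resolvent z) (sphere c r) :=
    hg.fun_const_smul _
  have h1 := (ContinuousLinearMap.mul ℂ (E →L[ℂ] E) (A.resolvent μ)).normCircleIntegral_comp_comm hr.le
    (f := fun z => (z - w)⁻¹ • 1 + (μ - w) • (z - w)⁻¹ • A.resolvent z - A.resolvent z)
    ((hi1.add hg1).sub hc)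
  simp only [ContinuousLinearMap.mul_apply'] at h1
  have e1 := normCircleIntegral_smul_const (c := c) (r := r) (fun z => (z - w)⁻¹) (1 : E →L[ℂ] E)
  have e2 := normCircleIntegral_smul (c := c) (r := r) (μ - w) fun z => (z - w)⁻¹ • A.resolvent z
  have e3 := normCircleIntegral_add hr.le hi1 hg1
  have e4 := normCircleIntegral_sub hr.le (hi1.fun_add hg1) hc
  rw [e3, e1, e2] at e4
  refine Eq.trans ?_ (h1.symm.trans (congrArg (A.resolvent μ * ·) e4))
  refine normCircleIntegral_congr hr.le fun z hz => ?_
  have h2 : (z - w)⁻¹ • (1 : E →L[ℂ] E) + (μ - w) • (z - w)⁻¹ • A.resolvent z - A.resolvent z =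
      (z - w)⁻¹ • (1 + (μ - z) • A.resolvent z) := by
    have h3 : (μ - w) * (z - w)⁻¹ = (z - w)⁻¹ * (μ - z) + 1 := by
      have := hne z hz
      field_simp
      ring
    rw [smul_smul, h3, add_smul, one_smul, smul_add, smul_smul]
    abel
  rw [h2, mul_smul_comm, ← resolvent_eq_mul hμ (hs hz)]

/-- `(w - A) G(w) = n(w) - P` for the Cauchy transform `G` of the resolvent. -/
lemma cauchyResolvent_spec (hr : 0 < r) (hs : sphere c r ⊆ A.resolventSet) (hw : w ∉ sphere c r) (x : E) :
    ∃ h : A.cauchyResolvent c r w x ∈ A.domain, w • A.cauchyResolvent c r w x -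
      A ⟨A.cauchyResolvent c r w x, h⟩ =
      normCircleIntegral c r (fun z => (z - w)⁻¹) • x - A.rieszProj c r x := by
  have hμ : c + r ∈ A.resolventSet := hs (by simp [abs_of_pos hr])
  set μ := c + (r : ℂ)
  have hR := isResolventAt_resolvent hμ
  have h1 := congrArg (fun S : E →L[ℂ] E => S x) (cauchyResolvent_eq_mul hr hs hw hμ)
  simp only [mul_apply_eq_comp] at h1
  refine ⟨h1 ▸ hR.mem_domain _, ?_⟩
  rw [map_mk_eq _ h1 (hR.mem_domain _), hR.map_apply, ← h1]
  simp only [_root_.sub_apply, _root_.add_apply, _root_.smul_apply, one_apply_eq_self]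
  module

/-- The spectrum in the closed disc is compact and misses the circle, so it stays in a smaller disc;
the maximum with r/2 keeps the radius positive. -/
lemma exists_smaller_radius (hr : 0 < r) (hs : sphere c r ⊆ A.resolventSet) :
    ∃ r', 0 < r' ∧ r' < r ∧ closedBall c r \ ball c r' ⊆ A.resolventSet := by
  have h1 : A.spectrum ∩ closedBall c r ⊆ ball c r := by
    rintro z ⟨hz, hz'⟩
    refine lt_of_le_of_ne hz' fun h => hz (hs h)
  obtain ⟨s, hs1, hs2⟩ := exists_lt_subset_ball (isClosed_spectrum.inter isClosed_closedBall) h1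
  refine ⟨max s (r / 2), by positivity, max_lt hs1 (by linarith), fun z hz => ?_⟩
  by_contra hn
  exact hz.2 (ball_subset_ball (le_max_left _ _) (hs2 ⟨hn, hz.1⟩))

lemma cauchyResolvent_eq_of_mem_ball (hr : 0 < r) (hs : sphere c r ⊆ A.resolventSet)
    (hw : w ∈ ball c r) (hw' : w ∈ A.resolventSet) :
    A.cauchyResolvent c r w = A.resolvent w * (1 - A.rieszProj c r) := by
  have h := cauchyResolvent_eq_mul hr hs (fun h => (mem_ball.1 hw).ne h) hw'
  rwa [normCircleIntegral_sub_inv_of_mem_ball hw, sub_self, zero_smul, add_zero, one_smul] at h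

/-- Riesz integrals over a circle in the resolvent set are idempotent. -/
theorem rieszProj_mul_self (hr : 0 < r) (hs : sphere c r ⊆ A.resolventSet) :
    A.rieszProj c r * A.rieszProj c r = A.rieszProj c r := by
  obtain ⟨r', h0, h1, h2⟩ := exists_smaller_radius hr hs
  have hs' : sphere c r' ⊆ A.resolventSet := fun z hz => h2
    ⟨sphere_subset_closedBall.trans (closedBall_subset_closedBall h1.le) hz, fun h => (mem_ball.1 h).ne hz⟩
  have hrad : A.rieszProj c r = A.rieszProj c r' := by
    rw [rieszProj, rieszProj, normCircleIntegral, normCircleIntegral,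
      Complex.circleIntegral_eq_of_differentiable_on_annulus_off_countable h0 h1.le countable_empty
        (continuousOn_resolvent h2) fun z hz => differentiableAt_resolvent (h2
          ⟨ball_subset_closedBall hz.1.1, fun h => hz.1.2 (ball_subset_closedBall h)⟩)]
  have hmul := ((ContinuousLinearMap.mul ℂ (E →L[ℂ] E)).flip
    (1 - A.rieszProj c r)).normCircleIntegral_comp_comm h0.le (continuousOn_resolvent hs')
  simp only [ContinuousLinearMap.mul_apply', ContinuousLinearMap.flip_apply] at hmul
  -- A Cauchy transform is analytic throughout the open disc, also at points of the spectrum, so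
  -- Cauchy's theorem applies on the smaller circle.
  have hG : normCircleIntegral c r' (A.cauchyResolvent c r) = 0 := by
    refine normCircleIntegral_eq_zero h0.le fun z hz => ?_
    lift r to NNReal using hr.le
    have hps := hasFPowerSeriesOn_cauchy_integral ((continuousOn_resolvent hs).circleIntegrable hr.le)
      (by exact_mod_cast hr)
    have hz' : z ∈ Metric.eball c (r : ENNReal) := by
      rw [Metric.eball_coe]
      exact lt_of_le_of_lt hz h1
    exact (hps.analyticAt_of_mem hz').differentiableAt
  have h3 : A.rieszProj c r' * (1 - A.rieszProj c r) = 0 := by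
    rw [← hG, rieszProj, hmul]
    refine normCircleIntegral_congr h0.le fun z hz => ?_
    rw [cauchyResolvent_eq_of_mem_ball hr hs (sphere_subset_closedBall.trans
      (closedBall_subset_ball h1) hz) (hs' hz)]
  rw [← hrad, mul_sub, mul_one, sub_eq_zero] at h3
  exact h3.symm

lemma commutesWith_rieszProj (hr : 0 < r) (hs : sphere c r ⊆ A.resolventSet) :
    A.CommutesWith (A.rieszProj c r) := by
  have hμ : c + r ∈ A.resolventSet := hs (by simp [abs_of_pos hr])
  exact (isResolventAt_resolvent hμ).commutesWith (commute_rieszProj hr hs hμ)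

lemma commutesWith_cauchyResolvent (hr : 0 < r) (hs : sphere c r ⊆ A.resolventSet) (hw : w ∉ sphere c r) :
    A.CommutesWith (A.cauchyResolvent c r w) := by
  have hμ : c + r ∈ A.resolventSet := hs (by simp [abs_of_pos hr])
  exact (isResolventAt_resolvent hμ).commutesWith (commute_cauchyResolvent hr hs hw hμ)

/-- The open disc lies in the resolvent set of the complementary part. -/
lemma ball_subset_resolventSet_part (hr : 0 < r) (hs : sphere c r ⊆ A.resolventSet) :
    ball c r ⊆ (A.part (1 - A.rieszProj c r)).resolventSet := by
  intro w hw
  have hw' : w ∉ sphere c r := fun h => (mem_ball.1 hw).ne h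
  -- Inside, the winding number is 1, and Px = 0 on this range, so the Cauchy transform itself
  -- inverts w - A there.
  refine ⟨_, isResolventAt_part (one_sub_mul_self (rieszProj_mul_self hr hs))
    (commutesWith_rieszProj hr hs).one_sub (commutesWith_cauchyResolvent hr hs hw') fun x hx => ?_⟩
  obtain ⟨h1, h2⟩ := cauchyResolvent_spec hr hs hw' x
  refine ⟨h1, h2.trans ?_⟩
  rw [normCircleIntegral_sub_inv_of_mem_ball hw, one_smul]
  exact hx

/-- The exterior of the disc lies in the resolvent set of the part in the range of the Riesz
projection. -/
lemma compl_closedBall_subset_resolventSet_part (hr : 0 < r) (hs : sphere c r ⊆ A.resolventSet) :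
    (closedBall c r)ᶜ ⊆ (A.part (A.rieszProj c r)).resolventSet := by
  intro w hw
  have hw' : w ∉ sphere c r := fun h => hw (sphere_subset_closedBall h)
  have hcomm := commutesWith_cauchyResolvent hr hs hw'
  -- Outside, the winding number is 0, and Px = x on this range, so minus the Cauchy transform is
  -- the inverse.
  refine ⟨_, isResolventAt_part (K := -A.cauchyResolvent c r w) (rieszProj_mul_self hr hs)
    (commutesWith_rieszProj hr hs) (fun x => ?_) fun x hx => ?_⟩
  · obtain ⟨h1, h2⟩ := hcomm x
    refine ⟨A.domain.neg_mem h1, (A.map_neg ⟨_, h1⟩).trans ?_⟩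
    rw [h2]
    rfl
  · obtain ⟨h1, h2⟩ := cauchyResolvent_spec hr hs hw' x
    refine ⟨A.domain.neg_mem h1, ?_⟩
    have h3 : A ⟨(-A.cauchyResolvent c r w) x, A.domain.neg_mem h1⟩ = -A ⟨_, h1⟩ :=
      A.map_neg ⟨_, h1⟩
    rw [normCircleIntegral_sub_inv_of_notMem hr.le hw, zero_smul, hx, zero_sub] at h2
    rw [h3, _root_.neg_apply, smul_neg, neg_sub_neg, ← neg_sub, h2, neg_neg]

/-- The spectra of the two parts. -/
theorem spectrum_part_rieszProj (hr : 0 < r) (hs : sphere c r ⊆ A.resolventSet) :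
    (A.part (A.rieszProj c r)).spectrum = A.spectrum ∩ ball c r ∧
      (A.part (1 - A.rieszProj c r)).spectrum = A.spectrum \ ball c r := by
  have hP := rieszProj_mul_self hr hs
  have hPA := commutesWith_rieszProj hr hs
  have hQ := one_sub_mul_self hP
  have h1 : A.resolventSet ⊆ (A.part (A.rieszProj c r)).resolventSet := fun z hz =>
    ⟨_, (isResolventAt_resolvent hz).part hP (commute_rieszProj hr hs hz)⟩
  have h2 : A.resolventSet ⊆ (A.part (1 - A.rieszProj c r)).resolventSet := fun z hz =>
    ⟨_, (isResolventAt_resolvent hz).part hQ ((Commute.one_left _).sub_left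
      (commute_rieszProj hr hs hz))⟩
  have h3 := ball_subset_resolventSet_part hr hs
  have h4 := compl_closedBall_subset_resolventSet_part hr hs
  have h5 : ∀ z, z ∈ (A.part (A.rieszProj c r)).resolventSet →
      z ∈ (A.part (1 - A.rieszProj c r)).resolventSet → z ∈ A.resolventSet := fun z hz hz' =>
    mem_resolventSet_of_parts hP hQ (add_sub_cancel _ _) hPA hPA.one_sub hz hz'
  have h6 : ∀ z, z ∉ ball c r → z ∈ (A.part (A.rieszProj c r)).resolventSet := by
    intro z hz
    by_cases h : z ∈ closedBall c r
    · exact h1 (hs (le_antisymm h (not_lt.1 hz)))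
    · exact h4 h
  constructor
  · ext z
    refine ⟨fun hz => ⟨fun h => hz (h1 h), by_contra fun h => hz (h6 z h)⟩,
      fun hz h => hz.1 (h5 z h (h3 hz.2))⟩
  · ext z
    exact ⟨fun hz => ⟨fun h => hz (h2 h), fun h => hz (h3 h)⟩, fun hz h => hz.1 (h5 z (h6 z hz.2) h)⟩

end LinearPMap

/-! ### Spectrum and resolvent of sectorial operators. -/

namespace LinearPMap

open Metric

variable {E : Type*} [NormedAddCommGroup E] [NormedSpace ℂ E] {A : E →ₗ.[ℂ] E}

/-- An argument below φ would force Re w > ‖w‖ cos φ ≥ |b|. -/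
lemma le_abs_arg_of_re_le {φ b : ℝ} (h0 : 0 < φ) (h1 : φ < Real.pi / 2) {w : ℂ} (hw : w ≠ 0)
    (hre : w.re ≤ b) (hb : |b| / Real.cos φ ≤ ‖w‖) : φ ≤ |Complex.arg w| := by
  by_contra! h
  have hcos : 0 < Real.cos φ := Real.cos_pos_of_mem_Ioo ⟨by linarith, h1⟩
  have h2 := Real.cos_lt_cos_of_nonneg_of_le_pi (abs_nonneg _) (by linarith [Real.pi_pos]) h
  rw [Real.cos_abs, Complex.cos_arg hw, lt_div_iff₀ (norm_pos_iff.2 hw)] at h2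
  rw [div_le_iff₀ hcos] at hb
  have := le_abs_self b
  linarith

/-- Far out in a left half-plane, a sectorial operator has its resolvent estimate. -/
lemma IsSectorial.exists_resolvent_bound (hA : A.IsSectorial) (b : ℝ) :
    ∃ a M c : ℝ, ∀ z : ℂ, z.re ≤ b → M < ‖z - a‖ →
      z ∈ A.resolventSet ∧ ‖A.resolvent z‖ ≤ c / (‖z - a‖ + 1) := by
  obtain ⟨-, -, a, φ, c, h0, h1, h2⟩ := hA
  have hcos : 0 < Real.cos φ := Real.cos_pos_of_mem_Ioo ⟨by linarith, h1⟩
  have hM : 0 ≤ |b - a| / Real.cos φ := by positivity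
  refine ⟨a, |b - a| / Real.cos φ, c, fun z hz hz' => h2 z ?_⟩
  refine le_abs_arg_of_re_le (b := b - a) h0 h1 ?_ (by simpa using hz) hz'.le
  exact norm_pos_iff.1 (hM.trans_lt hz')

lemma IsSectorial.isBounded_spectrum_inter (hA : A.IsSectorial) (b : ℝ) :
    Bornology.IsBounded (A.spectrum ∩ {z : ℂ | z.re ≤ b}) := by
  obtain ⟨a, M, c, h⟩ := hA.exists_resolvent_bound b
  refine (isBounded_closedBall (x := (a : ℂ)) (r := M)).subset fun z hz => ?_
  rw [mem_closedBall, dist_eq_norm]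
  by_contra! hn
  exact hz.1 (h z hz.2 hn).1

/-- Compactness makes the set closed in the sphere, away from ∞; it is open in the extended spectrum
as the trace of the open left half-plane. -/
lemma isSpectralSet_left {σ : Set ℂ} (hσ : σ = A.spectrum ∩ {z : ℂ | z.re < 0}) (hc : IsCompact σ) :
    A.IsSpectralSet ((fun z : ℂ => (z : OnePoint ℂ)) '' σ) := by
  refine ⟨?_, ?_, ?_⟩
  · rintro _ ⟨z, hz, rfl⟩
    rw [hσ] at hz
    exact Or.inr ⟨z, hz.1, rfl⟩
  · exact (OnePoint.isClosed_image_coe.2 ⟨hc.isClosed, hc⟩).preimage continuous_subtype_val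
  · have h1 : IsOpen ((fun z : ℂ => (z : OnePoint ℂ)) '' {z : ℂ | z.re < 0}) :=
      OnePoint.isOpen_image_coe.2 (isOpen_lt Complex.continuous_re continuous_const)
    convert! h1.preimage (continuous_subtype_val (p := (· ∈ A.extSpectrum))) using 1
    ext ⟨x, hx⟩
    constructor
    · rintro ⟨z, hz, h⟩
      rw [hσ] at hz
      exact ⟨z, hz.2, h⟩
    · rintro ⟨z, hz, rfl⟩
      rcases hx with hx | ⟨w, hw, hx⟩
      · exact absurd hx (OnePoint.coe_ne_infty z)
      · have : w = z := OnePoint.coe_injective hx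
        subst this
        exact ⟨w, hσ ▸ ⟨hw, hz⟩, rfl⟩

lemma IsSpectralSet.sdiff {τ : Set (OnePoint ℂ)} (h : A.IsSpectralSet τ) :
    A.IsSpectralSet (A.extSpectrum \ τ) := by
  refine ⟨sdiff_subset, ?_⟩
  have : ((↑) ⁻¹' (A.extSpectrum \ τ) : Set A.extSpectrum) = ((↑) ⁻¹' τ : Set A.extSpectrum)ᶜ := by
    ext x
    simp
  rw [this]
  exact h.2.compl

lemma IsResolventAt.of_toPMap {f : E →L[ℂ] E} {z : ℂ} {R : E →L[ℂ] E}
    (h : ((f : E →ₗ[ℂ] E).toPMap ⊤).IsResolventAt z R) : z • R - f * R = 1 := by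
  ext x
  obtain ⟨_, h2⟩ := h.1 x
  exact h2

lemma re_le_of_mem_closedBall {R α : ℝ} {z : ℂ} (hz : z ∈ closedBall (-(R : ℂ)) (R - α)) :
    z.re ≤ -α := by
  rw [mem_closedBall, dist_eq_norm, sub_neg_eq_add] at hz
  have := (Complex.re_le_norm _).trans hz
  simp only [Complex.add_re, Complex.ofReal_re] at this
  linarith

/-- The left part of the spectrum lies in a disc contained in the left half-plane. -/
lemma IsSectorial.exists_circle (hA : A.IsSectorial) {α : ℝ} (hα : 0 < α)
    (hgap : ∀ z ∈ A.spectrum, 2 * α ≤ |z.re|) :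
    ∃ (c : ℂ) (r : ℝ), 0 < r ∧ sphere c r ⊆ A.resolventSet ∧ (∀ z ∈ closedBall c r, z.re ≤ -α) ∧
      A.spectrum ∩ ball c r = A.spectrum ∩ {z : ℂ | z.re < 0} := by
  obtain ⟨M, hM⟩ := (hA.isBounded_spectrum_inter 0).exists_norm_le
  -- The disc with centre -R and radius R - α reaches exactly to -α. For |z| ≤ M and Re z ≤ -2α, |z
  -- + R|² ≤ M² - 4αR + R², which is below (R - α)² because 2αR = M² + 4α².
  set R := M ^ 2 / (2 * α) + 2 * α with hR
  have hR' : 2 * α * R = M ^ 2 + 4 * α ^ 2 := by rw [hR]; field_simp; ring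
  have hRα : 0 < R - α := by
    have : 0 ≤ M ^ 2 / (2 * α) := by positivity
    linarith
  have hre : ∀ z ∈ closedBall (-(R : ℂ)) (R - α), z.re ≤ -α := fun z => re_le_of_mem_closedBall
  have hin : ∀ z ∈ A.spectrum, z.re < 0 → z ∈ ball (-(R : ℂ)) (R - α) := by
    intro z hz h0
    have h1 := hgap z hz
    rw [abs_of_neg h0] at h1
    have h2 := hM z ⟨hz, h0.le⟩
    rw [mem_ball, dist_eq_norm, sub_neg_eq_add]
    refine lt_of_pow_lt_pow_left₀ 2 hRα.le ?_
    have h3 : ‖z‖ ^ 2 ≤ M ^ 2 := pow_le_pow_left₀ (norm_nonneg z) h2 2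
    rw [Complex.sq_norm, Complex.normSq_apply] at h3 ⊢
    simp only [Complex.add_re, Complex.ofReal_re, Complex.add_im, Complex.ofReal_im, add_zero]
    have h4 : 0 < R := by linarith
    nlinarith
  refine ⟨-(R : ℂ), R - α, hRα, fun z hz => ?_, hre, ?_⟩
  · by_contra hn
    have h1 := hre z (sphere_subset_closedBall hz)
    exact (mem_ball.1 (hin z hn (by linarith))).ne hz
  · ext z
    refine ⟨fun h => ⟨h.1, ?_⟩, fun h => ⟨h.1, hin z h.1 h.2⟩⟩
    have h1 := hre z (ball_subset_closedBall h.2)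
    simp only [mem_ofPred_eq]
    linarith

variable [CompleteSpace E]

lemma IsSectorial.isCompact_spectrum_inter (hA : A.IsSectorial) (b : ℝ) :
    IsCompact (A.spectrum ∩ {z : ℂ | z.re ≤ b}) :=
  isCompact_of_isClosed_isBounded
    (isClosed_spectrum.inter (isClosed_le Complex.continuous_re continuous_const))
    (hA.isBounded_spectrum_inter b)

/-- Far out the sectorial estimate is comparable to 1/|z - δ|; what remains of the closed half-plane
is compact, and the resolvent is continuous there. -/
lemma IsSectorial.exists_hasHalfPlaneBound (hA : A.IsSectorial) {δ : ℝ}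
    (hδ : ∀ z : ℂ, z.re ≤ δ → z ∈ A.resolventSet) : ∃ C : ℝ, A.HasHalfPlaneBound δ C := by
  obtain ⟨a, M, c, h⟩ := hA.exists_resolvent_bound δ
  have hK : IsCompact ({z : ℂ | z.re ≤ δ} ∩ closedBall (a : ℂ) M) :=
    (isCompact_closedBall _ _).inter_left (isClosed_le Complex.continuous_re continuous_const)
  have hcont : ContinuousOn (fun z : ℂ => ‖z - δ‖ * ‖A.resolvent z‖)
      ({z : ℂ | z.re ≤ δ} ∩ closedBall (a : ℂ) M) := by
    have := continuousOn_resolvent (A := A) (s := {z : ℂ | z.re ≤ δ} ∩ closedBall (a : ℂ) M)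
      fun z hz => hδ z hz.1
    fun_prop
  obtain ⟨C, hC⟩ := hK.exists_bound_of_continuousOn hcont
  refine ⟨max C (c * (1 + ‖(a : ℂ) - δ‖)), fun z hz => ⟨hδ z hz.le, ?_⟩⟩
  have hne : 0 < ‖z - δ‖ := norm_pos_iff.2 (sub_ne_zero.2 fun h => by simp [h] at hz)
  rw [le_div_iff₀ hne, mul_comm]
  rcases le_or_gt ‖z - a‖ M with hM | hM
  · refine le_trans ?_ (le_max_left _ _)
    have := hC z ⟨hz.le, by rwa [mem_closedBall, dist_eq_norm]⟩
    exact (le_abs_self _).trans this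
  · refine le_trans ?_ (le_max_right _ _)
    have h1 := (h z hz.le hM).2
    have h3 : 0 < ‖z - a‖ + 1 := by positivity
    rw [le_div_iff₀ h3] at h1
    have h2 : ‖z - δ‖ ≤ (‖z - a‖ + 1) * (1 + ‖(a : ℂ) - δ‖) := by
      have h4 := norm_add_le (z - a) ((a : ℂ) - δ)
      rw [sub_add_sub_cancel] at h4
      nlinarith [norm_nonneg (z - a), norm_nonneg ((a : ℂ) - δ)]
    calc ‖z - δ‖ * ‖A.resolvent z‖
        ≤ (‖z - a‖ + 1) * (1 + ‖(a : ℂ) - δ‖) * ‖A.resolvent z‖ := by gcongr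
      _ = ‖A.resolvent z‖ * (‖z - a‖ + 1) * (1 + ‖(a : ℂ) - δ‖) := by ring
      _ ≤ _ := by gcongr

/-- The spectrum of a hyperbolic sectorial operator has a gap around the imaginary axis. -/
lemma IsSectorial.exists_gap (hA : A.IsSectorial) (hyp : A.IsHyperbolic) :
    ∃ α : ℝ, 0 < α ∧ ∀ z ∈ A.spectrum, 2 * α ≤ |z.re| := by
  rcases (A.spectrum ∩ {z : ℂ | z.re ≤ 1}).eq_empty_or_nonempty with he | hne
  · refine ⟨1 / 2, by norm_num, fun z hz => ?_⟩
    by_contra! h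
    have : z ∈ A.spectrum ∩ {z : ℂ | z.re ≤ 1} := ⟨hz, by
      have := le_abs_self z.re
      simp only [mem_ofPred_eq]
      linarith⟩
    rw [he] at this
    exact this
  · obtain ⟨w, hw, hmin⟩ := (hA.isCompact_spectrum_inter 1).exists_isMinOn hne
      (f := fun z : ℂ => |z.re|) (by fun_prop)
    have hw0 : 0 < |w.re| := abs_pos.2 fun h => by
      have : w ∈ A.spectrum ∩ {z : ℂ | z.re = 0} := ⟨hw.1, h⟩
      rw [hyp] at this
      exact this
    -- The compact piece Re z ≤ 1 gives the first bound, and the spectrum with Re z > 1 the second;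
    -- both are halved to meet the gap 2α.
    refine ⟨min (|w.re| / 2) (1 / 2), by positivity, fun z hz => ?_⟩
    rcases le_or_gt z.re 1 with h | h
    · have := hmin ⟨hz, h⟩
      simp only [mem_ofPred_eq] at this
      linarith [min_le_left (|w.re| / 2) (1 / 2)]
    · have := le_abs_self z.re
      linarith [min_le_right (|w.re| / 2) (1 / 2)]

/-- The part of `A` in the range of the Riesz projection is bounded. -/
lemma exists_part_rieszProj_eq {c : ℂ} {r : ℝ} (hr : 0 < r) (hs : sphere c r ⊆ A.resolventSet) :
    ∃ B : rangeOf (A.rieszProj c r) →L[ℂ] rangeOf (A.rieszProj c r),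
      A.part (A.rieszProj c r) =
        (B : rangeOf (A.rieszProj c r) →ₗ[ℂ] rangeOf (A.rieszProj c r)).toPMap ⊤ := by
  have hμ : c + r ∈ A.resolventSet := hs (by simp [abs_of_pos hr])
  set μ := c + (r : ℂ)
  have hR := isResolventAt_resolvent hμ
  have hP := rieszProj_mul_self hr hs
  obtain ⟨L, hL⟩ := exists_rieszProj_eq_mul hr hs hμ
  have hx : ∀ x : rangeOf (A.rieszProj c r), (x : E) = A.resolvent μ (L x) := fun x =>
    (apply_of_mem_rangeOf hP x).symm.trans (congrArg (fun S : E →L[ℂ] E => S x) hL)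
  -- On the range x = R(μ)Lx, hence Ax = μx - Lx.
  refine ⟨compress _ (μ • 1 - L), LinearPMap.ext ?_ ?_⟩
  · refine eq_top_iff.2 fun x _ => ?_
    have := hR.mem_domain (L x)
    rw [← hx] at this
    exact this
  · intro x hf hg
    have hf' : (x : E) ∈ A.domain := hf
    ext
    change A.rieszProj c r (A ⟨(x : E), hf'⟩) = A.rieszProj c r ((μ • (1 : E →L[ℂ] E) - L) x)
    congr 1
    rw [map_mk_eq hf' (hx x) (hR.mem_domain _), hR.map_apply, ← hx]
    rfl

/-- Exponential decay on the range of the Riesz projection. -/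
lemma exists_norm_exp_part_le {c : ℂ} {r b : ℝ} (hr : 0 < r) (hs : sphere c r ⊆ A.resolventSet)
    (hb : ∀ z ∈ sphere c r, z.re ≤ b)
    {B : rangeOf (A.rieszProj c r) →L[ℂ] rangeOf (A.rieszProj c r)}
    (hB : A.part (A.rieszProj c r) =
      (B : rangeOf (A.rieszProj c r) →ₗ[ℂ] rangeOf (A.rieszProj c r)).toPMap ⊤) :
    ∃ N : ℝ, 0 ≤ N ∧ ∀ t : ℝ, 0 ≤ t → ‖operatorExp ((t : ℂ) • B)‖ ≤ N * Real.exp (b * t) := by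
  have hP := rieszProj_mul_self hr hs
  have hcs : CompleteSpace (rangeOf (A.rieszProj c r)) := (isClosed_rangeOf hP).completeSpace_coe
  have hcont : ContinuousOn (fun z => compress (A.rieszProj c r) (A.resolvent z)) (Metric.sphere c r) :=
    (compress (A.rieszProj c r)).continuous.comp_continuousOn (continuousOn_resolvent hs)
  refine exists_norm_exp_smul_le (c := c) hr.le (R := fun z => compress (A.rieszProj c r) (A.resolvent z))
    hcont (fun z hz => ?_) ?_ hb
  · have h1 := (isResolventAt_resolvent (hs hz)).part hP (commute_rieszProj hr hs (hs hz))
    rw [hB] at h1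
    exact h1.of_toPMap
  · rw [← ContinuousLinearMap.normCircleIntegral_comp_comm _ hr.le (continuousOn_resolvent hs)]
    exact compress_self hP

end LinearPMap
end

/-! ### Assembly of the dichotomy. -/

theorem mainTheorem10 {E : Type*} [NormedAddCommGroup E] [NormedSpace ℂ E] [CompleteSpace E]
    (A : E →ₗ.[ℂ] E) (hA : A.IsSectorial) (hyp : A.IsHyperbolic)
    (σm : Set ℂ) (hσm : σm = A.spectrum ∩ {z : ℂ | z.re < 0})
    (σmExt : Set (OnePoint ℂ)) (hσmExt : σmExt = (fun z : ℂ => (z : OnePoint ℂ)) '' σm)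
    (σpExt : Set (OnePoint ℂ)) (hσpExt : σpExt = A.extSpectrum \ σmExt) :
    ∃ α : ℝ, 0 < α ∧
      -- the spectrum stays away from the imaginary axis
      (∀ z ∈ A.spectrum, α ≤ |z.re|) ∧
      -- the part of the spectrum in the left half-plane is a bounded spectral set
      Bornology.IsBounded σm ∧ A.IsSpectralSet σmExt ∧
      -- the spectral projections, and the splitting of the space and of `A`
      ∃ Pm Pp : E →L[ℂ] E,
        A.IsSpectralProjection σmExt Pm ∧ A.IsSpectralProjection σpExt Pp ∧
        Pm * Pm = Pm ∧ Pp * Pp = Pp ∧ Pm * Pp = 0 ∧ Pp * Pm = 0 ∧ Pm + Pp = 1 ∧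
        A.CommutesWith Pm ∧ A.CommutesWith Pp ∧
        -- `A₋` is everywhere defined and bounded, `A₊` is sectorial
        ∃ Am : LinearPMap.rangeOf Pm →L[ℂ] LinearPMap.rangeOf Pm,
          A.part Pm = (Am : LinearPMap.rangeOf Pm →ₗ[ℂ] LinearPMap.rangeOf Pm).toPMap ⊤ ∧
          (A.part Pm).spectrum = σm ∧
          (A.part Pp).IsSectorial ∧
          (A.part Pp).extSpectrum = σpExt ∧
          -- location of the two spectra
          (∀ z ∈ (A.part Pm).spectrum, z.re ≤ -α) ∧
          (∀ z ∈ (A.part Pp).spectrum, α < z.re) ∧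
          -- the exponential bounds
          ∃ N ν : ℝ, 0 < N ∧ 0 < ν ∧
            (∀ t : ℝ, 0 ≤ t →
              ‖operatorExp ((t : ℂ) • Am)‖ ≤ N * Real.exp (-ν * t)) ∧
            ∃ T : ℝ → LinearPMap.rangeOf Pp →L[ℂ] LinearPMap.rangeOf Pp,
              IsSemigroupGeneratedBy T (-(A.part Pp)) ∧
              (∀ t : ℝ, 0 < t → ‖T t‖ ≤ N * Real.exp (-ν * t)) ∧
              (∀ t : ℝ, 0 < t → ∀ x : LinearPMap.rangeOf Pp,
                ∃ h : T t x ∈ (A.part Pp).domain,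
                  ‖A.part Pp ⟨T t x, h⟩‖ ≤ N * t⁻¹ * Real.exp (-ν * t) * ‖x‖) := by
  obtain ⟨α, hα, hgap⟩ := hA.exists_gap hyp
  obtain ⟨c, r, hr, hs, hre, hball⟩ := hA.exists_circle hα hgap
  have hcompact : IsCompact σm := by
    have : σm = (A.spectrum ∩ {z : ℂ | z.re ≤ 0}) := by
      rw [hσm]
      ext z
      refine ⟨fun h => ⟨h.1, show z.re ≤ 0 from le_of_lt h.2⟩, fun h => ⟨h.1, show z.re < 0 from lt_of_le_of_ne (show z.re ≤ 0 from h.2) fun h0 => ?_⟩⟩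
      have := hgap z h.1
      rw [h0, abs_zero] at this
      linarith
    rw [this]
    exact hA.isCompact_spectrum_inter 0
  have hP := LinearPMap.rieszProj_mul_self hr hs
  have hPA := LinearPMap.commutesWith_rieszProj hr hs
  have hQ := LinearPMap.one_sub_mul_self hP
  obtain ⟨hspm, hspp⟩ := LinearPMap.spectrum_part_rieszProj hr hs
  have hσball : σm = A.spectrum ∩ Metric.ball c r := hσm.trans hball.symm
  have hSm : A.IsSpectralSet σmExt := hσmExt ▸ LinearPMap.isSpectralSet_left hσm hcompact
  have hSp : A.IsSpectralSet σpExt := hσpExt ▸ hSm.sdiff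
  have hRiesz : A.IsRieszIntegral σm (A.rieszProj c r) :=
    LinearPMap.isRieszIntegral_rieszProj hr hs (hσball ▸ inter_subset_right) hσball.ge
  have hmem : ∀ z : ℂ, (z : OnePoint ℂ) ∈ σmExt ↔ z ∈ σm := by
    intro z
    rw [hσmExt]
    exact OnePoint.coe_injective.mem_set_image
  have hinf : OnePoint.infty ∉ σmExt := by
    rw [hσmExt]
    rintro ⟨z, -, hz⟩
    exact OnePoint.coe_ne_infty z hz
  have hpos : ∀ z ∈ (A.part (1 - A.rieszProj c r)).spectrum, α < z.re := by
    intro z hz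
    rw [hspp] at hz
    have h1 := hgap z hz.1
    have h2 : ¬ z.re < 0 := fun h => hz.2 (hball.ge ⟨hz.1, h⟩).2
    rw [abs_of_nonneg (not_lt.1 h2)] at h1
    linarith
  obtain ⟨Am, hAm⟩ := LinearPMap.exists_part_rieszProj_eq hr hs
  obtain ⟨N₁, hN₁, hexp⟩ := LinearPMap.exists_norm_exp_part_le hr hs
    (fun z hz => hre z (Metric.sphere_subset_closedBall hz)) hAm
  have hsect : (A.part (1 - A.rieszProj c r)).IsSectorial := hA.part hQ hPA.one_sub fun z hz =>
    (Commute.one_left _).sub_left (LinearPMap.commute_rieszProj hr hs hz)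
  have hcs : CompleteSpace (LinearPMap.rangeOf (1 - A.rieszProj c r)) :=
    (LinearPMap.isClosed_rangeOf hQ).completeSpace_coe
  -- The gap 2α leaves the closed half-plane Re z ≤ α free of spectrum, so the shift δ = α is
  -- admissible.
  obtain ⟨C, hC⟩ := hsect.exists_hasHalfPlaneBound (δ := α) fun z hz => by
    by_contra hn
    exact (hpos z hn).not_ge hz
  have hC0 := hC.isPseudoResolvent.nonneg
  have hdecay : ∀ t : ℝ, 0 ≤ t → Real.exp (-α * t) ≤ Real.exp (-(α / 2) * t) := fun t ht =>
    Real.exp_le_exp.2 (by nlinarith)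
  -- The constant dominates all three bounds, with 1 added for positivity. The rate α/2 is the one
  -- left by the estimate of A₊e^{-A₊t}; the other two decay at rate α.
  refine ⟨α, hα, fun z hz => by linarith [hgap z hz], hcompact.isBounded, hSm, A.rieszProj c r,
    1 - A.rieszProj c r, ⟨hSm, Or.inl ⟨hinf, ?_⟩⟩, ⟨hSp, Or.inr ⟨?_, ?_⟩⟩, hP, hQ, ?_, ?_,
    add_sub_cancel _ _, hPA, hPA.one_sub, Am, hAm, hspm.trans hσball.symm, hsect, ?_,
    fun z hz => ?_, hpos, N₁ + Real.exp 1 * (C ^ 2 + 3 * C ^ 3) + 1, α / 2, by positivity, by positivity,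
    fun t ht => ?_, (A.part (1 - A.rieszProj c r)).expSemigroup α,
    hC.isSemigroupGeneratedBy hsect.2.1, fun t ht => ?_, fun t ht x => ?_⟩
  · convert hRiesz using 1
    ext z
    exact hmem z
  · rw [hσpExt]
    exact ⟨Or.inl rfl, hinf⟩
  · rw [sub_sub_cancel]
    convert hRiesz using 1
    ext z
    constructor
    · rintro ⟨h1, h2⟩
      by_contra h3
      refine h2 ?_
      rw [hσpExt]
      exact ⟨Or.inr ⟨z, h1, rfl⟩, fun h => h3 ((hmem z).1 h)⟩
    · intro h
      refine ⟨(hσball.le h).1, fun h2 => ?_⟩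
      rw [hσpExt] at h2
      exact h2.2 ((hmem z).2 h)
  · rw [mul_sub, mul_one, hP, sub_self]
  · rw [sub_mul, one_mul, hP, sub_self]
  · rw [LinearPMap.extSpectrum, hspp, hσpExt, LinearPMap.extSpectrum]
    ext x
    induction x using OnePoint.rec with
    | infty => exact ⟨fun _ => ⟨Or.inl rfl, hinf⟩, fun _ => Or.inl rfl⟩
    | coe z =>
      have h1 : ∀ s : Set ℂ, (z : OnePoint ℂ) ∈ insert OnePoint.infty ((fun z : ℂ => (z : OnePoint ℂ)) '' s) ↔
          z ∈ s := fun s => by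
        rw [mem_insert_iff, or_iff_right (OnePoint.coe_ne_infty z)]
        exact OnePoint.coe_injective.mem_set_image
      rw [Set.mem_sdiff, h1, h1, hmem, hσball]
      exact ⟨fun h => ⟨h.1, fun h2 => h.2 h2.2⟩, fun h => ⟨h.1, fun h2 => h.2 ⟨h.1, h2⟩⟩⟩
  · rw [hspm] at hz
    exact hre z (Metric.ball_subset_closedBall hz.2)
  · refine (hexp t ht).trans (mul_le_mul ?_ (hdecay t ht) (Real.exp_pos _).le (by positivity))
    have : 0 ≤ Real.exp 1 * (C ^ 2 + 3 * C ^ 3) := by positivity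
    linarith
  · refine (hC.norm_expSemigroup_le ht).trans
      (mul_le_mul ?_ (hdecay t ht.le) (Real.exp_pos _).le (by positivity))
    have h1 : 0 ≤ Real.exp 1 * (C ^ 2 + 2 * C ^ 3) := by positivity
    nlinarith
  · obtain ⟨hd, hb⟩ := hC.norm_map_expSemigroup_le hα ht x
    refine ⟨hd, hb.trans ?_⟩
    have h1 := Real.exp_pos (-(α / 2) * t)
    gcongr
    linarith
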